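/- Setting. Let $M$ be a smooth Hausdorff manifold of dimension $n+1$ with a smooth codimension-one foliation $\mathcal F$ and a smooth vector field $N$ transversal to $\mathcal F$. For a smooth Riemannian metric $g$ on $M$ for which $N$ is a unit normal of $\mathcal F$, let $\nabla$ be its Levi-Civita connection, let $\hat v=v-g(v,N)N$ be the $T\mathcal F$-component of a vector $v$, put $\hat g(v,w)=g(\hat v,\hat w)$, let $A v=-\nabla_{\hat v}N$ be the Weingarten operator extended by $A(N)=0$, put $\tau_j=\operatorname{tr}A^j$, $\vec\tau=(\tau_1,\dots,\tau_n)$ and $\hat b_j(v,w)=\hat g(A^jv,w)$. Fix functions $f_0,\dots,f_{n-1}\in C^2(\mathbb R^n)$ and put $h(b)=\sum_{j=0}^{n-1}f_j(\vec\tau)\,\hat b_j$. For a time-dependent metric $g_t$ these objects are denoted $\hat g_t$, $b_t$, etc. The extrinsic geometric flow (EGF) is the equation $\partial_t g_t=h(b_t)$ for smooth families $g_t$ of Riemannian metrics on $M$ for which $N$ is a unit normal of $\mathcal F$. Let $\mathcal D(\mathcal F,N)$ be the group of diffeomorphisms $\phi$ of $M$ that preserve $\mathcal F$ and $N$ (that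 is, $\phi_*T\mathcal F=T\mathcal F$ and $\phi_*N=N$), and let $\mathcal X(\mathcal F,N)$ be the set of smooth vector fields $X$ on $M$ that preserve $\mathcal F$ and $N$ (that is, $[X,T\mathcal F]\subset T\mathcal F$ and $[X,N]=0$). Let $J\subset\mathbb R$ be an interval with more than one point that contains $0$ (derivatives in $t$ are one-sided at end points of $J$ that belong to $J$). A solution $g_t$ $(t\in J)$ of the EGF is a self-similar extrinsic geometric soliton (EGS) if there are a smooth function $\sigma:J\to(0,\infty)$ with $\sigma(0)=1$ and diffeomorphisms $\phi_t\in\mathcal D(\mathcal F,N)$, depending smoothly on $t\in J$, with $\phi_0=\mathrm{id}_M$, such that $\hat g_t=\sigma(t)\,\phi_t^*\hat g_0$ for all $t\in J$. Theorem. (a) If $g_t$ $(t\in J)$ is a self-similar EGS, then there are a vector field $X\in\mathcal X(\mathcal F,N)$ and a constant $\varepsilon\in\mathbb R$ such that the metric $g_0$ satisfies $$h(b)=\varepsilon\,\hat g+\mathcal L_X\hat g.\qquad(*)$$ (b) Conversely, let $g_0$ be a Riemannian metric for which $N$ is a unit normal of $\mathcal F$, let $X\in\mathcal X(\mathcal F,N)$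 be complete (that is, $X$ generates a one-parameter group of diffeomorphisms of $M$), let $\varepsilon\in\mathbb R$, and suppose that $(*)$ holds for $g_0$. Let $\psi_t$ $(t\in\mathbb R)$ be the flow of $X$. Then $\psi_t\in\mathcal D(\mathcal F,N)$ for all $t$, and there is a solution $g_t$ $(t\in\mathbb R)$ of the EGF with initial metric $g_0$ such that $\hat g_t=e^{\varepsilon t}\psi_t^*\hat g_0$ for all $t$. In particular, $g_t$ is a self-similar EGS with $\sigma(t)=e^{\varepsilon t}$ and $\phi_t=\psi_t$. -/

import Mathlib

open Set Bundle
open scoped Manifold ContDiff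

noncomputable section

namespace EGF

/-- Vector fields (not assumed smooth) on a manifold `M` of dimension `n + 1`. -/
abbrev VectorField (n : ℕ) (M : Type*) [TopologicalSpace M]
    [ChartedSpace (EuclideanSpace ℝ (Fin (n + 1))) M] : Type _ :=
  (p : M) → TangentSpace (𝓡 (n + 1)) p

/-- Smooth Riemannian metrics on `M`. -/
abbrev Metric (n : ℕ) (M : Type*) [TopologicalSpace M]
    [ChartedSpace (EuclideanSpace ℝ (Fin (n + 1))) M] [IsManifold (𝓡 (n + 1)) ∞ M] : Type _ :=
  ContMDiffRiemannianMetric (𝓡 (n + 1)) ∞ (EuclideanSpace ℝ (Fin (n + 1)))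
    (TangentSpace (𝓡 (n + 1)) : M → Type _)

/-- Diffeomorphisms of `M`. -/
abbrev Diffeo (n : ℕ) (M : Type*) [TopologicalSpace M]
    [ChartedSpace (EuclideanSpace ℝ (Fin (n + 1))) M] : Type _ :=
  Diffeomorph (𝓡 (n + 1)) (𝓡 (n + 1)) M M ∞

/-- Families `p ↦ S p` of functions of two tangent vectors; all those used below are bilinear,
that is, (0,2)-tensor fields. -/
abbrev TwoTensor (n : ℕ) (M : Type*) [TopologicalSpace M]
    [ChartedSpace (EuclideanSpace ℝ (Fin (n + 1))) M] : Type _ :=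
  (p : M) → TangentSpace (𝓡 (n + 1)) p → TangentSpace (𝓡 (n + 1)) p → ℝ

variable {n : ℕ} {M : Type*} [TopologicalSpace M]
  [ChartedSpace (EuclideanSpace ℝ (Fin (n + 1))) M] [IsManifold (𝓡 (n + 1)) ∞ M]

/-- Smoothness of a vector field. -/
def SmoothField (X : VectorField n M) : Prop :=
  ContMDiff (𝓡 (n + 1)) (𝓡 (n + 1)).tangent ∞
    (fun p => (⟨p, X p⟩ : TangentBundle (𝓡 (n + 1)) M))

variable (n M) in
/-- A smooth codimension-one foliation `𝓕` of `M`, given by its tangent distribution `T𝓕`, together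
with a smooth vector field `N` transversal to it. The leaves are locally the level sets of a
submersion to `ℝ`, whose differential has kernel `T𝓕`. -/
structure OrientedFoliation where
  /-- The tangent space `T𝓕` of the leaf through a point. -/
  tangent : (p : M) → Submodule ℝ (TangentSpace (𝓡 (n + 1)) p)
  locally_submersion : ∀ p : M, ∃ U : Set M, IsOpen U ∧ p ∈ U ∧ ∃ u : M → ℝ,
    ContMDiffOn (𝓡 (n + 1)) 𝓘(ℝ, ℝ) ∞ u U ∧
    ∀ q ∈ U, mvfderiv (𝓡 (n + 1)) u q ≠ 0 ∧
      ∀ v : TangentSpace (𝓡 (n + 1)) q,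
        v ∈ tangent q ↔ mvfderiv (𝓡 (n + 1)) u q v = 0
  /-- The transversal field `N`. -/
  normal : VectorField n M
  smooth_normal : SmoothField normal
  transversal : ∀ p, normal p ∉ tangent p

/-- `N` is a unit normal field of `𝓕` with respect to `g`. -/
def IsAdapted (𝓕 : OrientedFoliation n M) (g : Metric n M) : Prop :=
  ∀ p, g.inner p (𝓕.normal p) (𝓕.normal p) = 1 ∧
    ∀ v ∈ 𝓕.tangent p, g.inner p v (𝓕.normal p) = 0

/-- The `T𝓕`-component `v - g(v, N) N` of a tangent vector `v`. -/
def hat (𝓕 : OrientedFoliation n M) (g : Metric n M) (p : M) :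
    TangentSpace (𝓡 (n + 1)) p →ₗ[ℝ] TangentSpace (𝓡 (n + 1)) p :=
  LinearMap.id - ((g.inner p (𝓕.normal p)).smulRight (𝓕.normal p)).toLinearMap

/-- The truncated metric `ĝ`. -/
def truncated (𝓕 : OrientedFoliation n M) (g : Metric n M) : TwoTensor n M :=
  fun p v w => g.inner p (hat 𝓕 g p v) (hat 𝓕 g p w)

/-- Affine connections on `M`; `nabla Y p v` is the derivative of `Y` at `p` along `v`. -/
abbrev Connection (n : ℕ) (M : Type*) [TopologicalSpace M]
    [ChartedSpace (EuclideanSpace ℝ (Fin (n + 1))) M] [IsManifold (𝓡 (n + 1)) ∞ M] : Type _ :=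
  CovariantDerivative (𝓡 (n + 1)) (EuclideanSpace ℝ (Fin (n + 1)))
    (TangentSpace (𝓡 (n + 1)) : M → Type _)

/-- `nabla` is the Levi-Civita connection of `g`: it is torsion free and
`v (g(Y, Z)) = g(∇_v Y, Z) + g(Y, ∇_v Z)`. These conditions determine `nabla Y p` for every field
`Y` that is differentiable at `p`. -/
def IsLeviCivita (g : Metric n M) (nabla : Connection n M) : Prop :=
  nabla.torsion = 0 ∧
  ∀ (p : M) (Y Z : VectorField n M),
    MDifferentiableAt (𝓡 (n + 1)) (𝓡 (n + 1)).tangent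
      (fun q => (⟨q, Y q⟩ : TangentBundle (𝓡 (n + 1)) M)) p →
    MDifferentiableAt (𝓡 (n + 1)) (𝓡 (n + 1)).tangent
      (fun q => (⟨q, Z q⟩ : TangentBundle (𝓡 (n + 1)) M)) p →
    ∀ v : TangentSpace (𝓡 (n + 1)) p,
      mvfderiv (𝓡 (n + 1)) (fun q => g.inner q (Y q) (Z q)) p v =
        g.inner p (nabla Y p v) (Z p) + g.inner p (Y p) (nabla Z p v)

/-- The extended Weingarten operator: `A v = -∇_v N` for `v` tangent to `𝓕`, and `A N = 0`. -/
def weingarten (𝓕 : OrientedFoliation n M) (g : Metric n M) (nabla : Connection n M) (p : M) :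
    Module.End ℝ (TangentSpace (𝓡 (n + 1)) p) :=
  -((nabla 𝓕.normal p).toLinearMap ∘ₗ hat 𝓕 g p)

/-- The vector `(τ₁, …, τₙ)` of the power sums `τⱼ = tr Aʲ`. -/
def tau (𝓕 : OrientedFoliation n M) (g : Metric n M) (nabla : Connection n M) (p : M) :
    Fin n → ℝ :=
  fun i => LinearMap.trace ℝ (TangentSpace (𝓡 (n + 1)) p)
    (weingarten 𝓕 g nabla p ^ ((i : ℕ) + 1))

/-- The tensor `b̂ⱼ(v, w) = ĝ(Aʲ v, w)`. -/
def bHat (𝓕 : OrientedFoliation n M) (g : Metric n M) (nabla : Connection n M) (j : ℕ) :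
    TwoTensor n M :=
  fun p v w => truncated 𝓕 g p ((weingarten 𝓕 g nabla p ^ j) v) w

/-- The tensor `h(b) = ∑_{0 ≤ j < n} fⱼ(τ₁, …, τₙ) b̂ⱼ`. -/
def hTensor (f : Fin n → (Fin n → ℝ) → ℝ) (𝓕 : OrientedFoliation n M) (g : Metric n M)
    (nabla : Connection n M) : TwoTensor n M :=
  fun p v w => ∑ j : Fin n, f j (tau 𝓕 g nabla p) * bHat 𝓕 g nabla j p v w

/-- The family `g t`, `t ∈ J`, is a solution of the extrinsic geometric flow `∂ₜ g = h(b)`: a smooth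
family of Riemannian metrics with unit normal `N`, satisfying the equation for all `t ∈ J`
(with one-sided derivatives at the end points of `J`). -/
structure IsEGF (f : Fin n → (Fin n → ℝ) → ℝ) (𝓕 : OrientedFoliation n M) (J : Set ℝ)
    (g : ℝ → Metric n M) : Prop where
  adapted : ∀ t ∈ J, IsAdapted 𝓕 (g t)
  smooth : ContMDiffOn (𝓘(ℝ, ℝ).prod (𝓡 (n + 1)))
    ((𝓡 (n + 1)).prod 𝓘(ℝ, EuclideanSpace ℝ (Fin (n + 1)) →L[ℝ]
      EuclideanSpace ℝ (Fin (n + 1)) →L[ℝ] ℝ)) ∞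
    (fun q : ℝ × M => TotalSpace.mk'
      (E := fun p : M => TangentSpace (𝓡 (n + 1)) p →L[ℝ] TangentSpace (𝓡 (n + 1)) p →L[ℝ] ℝ)
      (EuclideanSpace ℝ (Fin (n + 1)) →L[ℝ] EuclideanSpace ℝ (Fin (n + 1)) →L[ℝ] ℝ)
      q.2 ((g q.1).inner q.2)) (J ×ˢ univ)
  flow : ∀ t ∈ J, ∃ nabla : Connection n M, IsLeviCivita (g t) nabla ∧
    ∀ (p : M) (v w : TangentSpace (𝓡 (n + 1)) p),
      HasDerivWithinAt (fun s => (g s).inner p v w) (hTensor f 𝓕 (g t) nabla p v w) J t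

/-- The group `𝒟(𝓕, N)`: diffeomorphisms that preserve `𝓕` and `N`. -/
def PreservesFN (𝓕 : OrientedFoliation n M) (φ : Diffeo n M) : Prop :=
  ∀ p, (𝓕.tangent p).map (mfderiv (𝓡 (n + 1)) (𝓡 (n + 1)) φ p).toLinearMap = 𝓕.tangent (φ p) ∧
    mfderiv (𝓡 (n + 1)) (𝓡 (n + 1)) φ p (𝓕.normal p) = 𝓕.normal (φ p)

/-- The set `𝒳(𝓕, N)`: smooth vector fields `X` with `[X, T𝓕] ⊆ T𝓕` and `[X, N] = 0`. -/
def FieldPreservesFN (𝓕 : OrientedFoliation n M) (X : VectorField n M) : Prop :=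
  SmoothField X ∧
  (∀ Y : VectorField n M, SmoothField Y → (∀ p, Y p ∈ 𝓕.tangent p) →
    ∀ p, VectorField.mlieBracket (𝓡 (n + 1)) X Y p ∈ 𝓕.tangent p) ∧
  ∀ p, VectorField.mlieBracket (𝓡 (n + 1)) X 𝓕.normal p = 0

/-- The pull-back `φ^* S`. -/
def pullback (φ : Diffeo n M) (S : TwoTensor n M) : TwoTensor n M :=
  fun p v w => S (φ p) (mfderiv (𝓡 (n + 1)) (𝓡 (n + 1)) φ p v)
    (mfderiv (𝓡 (n + 1)) (𝓡 (n + 1)) φ p w)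

/-- The function `(ℒ_X S)(Y, Z) = X(S(Y, Z)) - S([X, Y], Z) - S(Y, [X, Z])`. -/
def lieDerivative (X : VectorField n M) (S : TwoTensor n M) (Y Z : VectorField n M) (p : M) : ℝ :=
  mvfderiv (𝓡 (n + 1)) (fun q => S q (Y q) (Z q)) p (X p)
    - S p (VectorField.mlieBracket (𝓡 (n + 1)) X Y p) (Z p)
    - S p (Y p) (VectorField.mlieBracket (𝓡 (n + 1)) X Z p)

/-- A family of diffeomorphisms `φ t` that is smooth in `(t, p)`, for `t ∈ J`. -/
def SmoothFamily (J : Set ℝ) (φ : ℝ → Diffeo n M) : Prop :=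
  ContMDiffOn (𝓘(ℝ, ℝ).prod (𝓡 (n + 1))) (𝓡 (n + 1)) ∞ (fun q : ℝ × M => φ q.1 q.2) (J ×ˢ univ)

/-- The solution `g` of the flow on the time interval `J` is self-similar, with scaling factor `σ`
and family of diffeomorphisms `φ`: `ĝ t = σ(t) φ t^* ĝ 0`. -/
structure IsSelfSimilarWith (f : Fin n → (Fin n → ℝ) → ℝ) (𝓕 : OrientedFoliation n M)
    (J : Set ℝ) (g : ℝ → Metric n M) (σ : ℝ → ℝ) (φ : ℝ → Diffeo n M) : Prop where
  isEGF : IsEGF f 𝓕 J g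
  scale_smooth : ContDiffOn ℝ ∞ σ J
  scale_pos : ∀ t ∈ J, 0 < σ t
  scale_zero : σ 0 = 1
  smooth : SmoothFamily J φ
  preserves : ∀ t ∈ J, PreservesFN 𝓕 (φ t)
  init : ∀ p, φ 0 p = p
  selfSimilar : ∀ t ∈ J, ∀ (p : M) (v w : TangentSpace (𝓡 (n + 1)) p),
    truncated 𝓕 (g t) p v w = σ t * pullback (φ t) (truncated 𝓕 (g 0)) p v w

/-- `g` is a self-similar extrinsic geometric soliton on the time interval `J`. -/
def IsSelfSimilarEGS (f : Fin n → (Fin n → ℝ) → ℝ) (𝓕 : OrientedFoliation n M)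
    (J : Set ℝ) (g : ℝ → Metric n M) : Prop :=
  ∃ (σ : ℝ → ℝ) (φ : ℝ → Diffeo n M), IsSelfSimilarWith f 𝓕 J g σ φ

/-- The soliton equation `h(b) = ε ĝ + ℒ_X ĝ` for the metric `g`. -/
def SolitonEquation (f : Fin n → (Fin n → ℝ) → ℝ) (𝓕 : OrientedFoliation n M) (g : Metric n M)
    (X : VectorField n M) (ε : ℝ) : Prop :=
  ∃ nabla : Connection n M, IsLeviCivita g nabla ∧
    ∀ Y Z : VectorField n M, SmoothField Y → SmoothField Z → ∀ p,
      hTensor f 𝓕 g nabla p (Y p) (Z p) =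
        ε * truncated 𝓕 g p (Y p) (Z p) + lieDerivative X (truncated 𝓕 g) Y Z p

/-- `ψ` is the global flow (the one-parameter group of diffeomorphisms) generated by `X`. -/
structure IsFlowOf (X : VectorField n M) (ψ : ℝ → Diffeo n M) : Prop where
  smooth : SmoothFamily univ ψ
  zero : ∀ p, ψ 0 p = p
  add : ∀ s t p, ψ (s + t) p = ψ s (ψ t p)
  integralCurve : ∀ p, IsMIntegralCurve (I := 𝓡 (n + 1)) (fun t => ψ t p) X

/-- An EGS structure `(g, X)` with constant `ε`: `N` is the unit normal for `g`, the vector field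
`X ∈ 𝒳(𝓕, N)` is complete, that is, it generates a one-parameter group of diffeomorphisms of `M`,
and the soliton equation holds. -/
structure IsEGSStructure (f : Fin n → (Fin n → ℝ) → ℝ) (𝓕 : OrientedFoliation n M)
    (g : Metric n M) (X : VectorField n M) (ε : ℝ) : Prop where
  adapted : IsAdapted 𝓕 g
  preserves : FieldPreservesFN 𝓕 X
  complete : ∃ ψ : ℝ → Diffeo n M, IsFlowOf X ψ
  equation : SolitonEquation f 𝓕 g X ε

end EGF

end

/-! Write η = g(·,N). Since T𝓕 and N split TM without reference to a metric, η is the same for every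
metric adapted to (𝓕, N) (`IsAdapted.inner_normal_eq`). Hence g = ĝ + η⊗η with a fixed second
summand, and along the flow only ĝ moves.

For (a), differentiate g_t = σ(t) φ_t^*ĝ_0 + η⊗η at t = 0. With X the velocity of φ_t at 0 and ε =
σ'(0), the right side gives ε ĝ_0 + ℒ_X ĝ_0 and the flow equation gives h(b). The identities φ_t_*N
= N and φ_t_*T𝓕 = T𝓕, differentiated at 0, show X ∈ 𝒳(𝓕, N). The analytic input is that the
derivative of the pull-backs of a (0,2)-tensor is its Lie derivative, even at an end point of J
(`IsVariation.hasDerivWithinAt_pullback`). It rests on the symmetry of mixed partial derivatives and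
on [X,Y]u = X(Yu) − Y(Xu).

For (b), put g_t = ψ_t^*(e^{εt} ĝ + η⊗η). By the group law, the derivative at any time t reduces to
one at time 0, so that ∂_t g_t = e^{εt} ψ_t^*(ε ĝ + ℒ_X ĝ) = e^{εt} ψ_t^*h(b). This equals h(b_t)
because h is natural under 𝒟(𝓕, N) (`hTensor_pullback`) and homogeneous of degree one under ĝ ↦ c ĝ
(`hTensor_rescale`): the Weingarten operator, hence every τ_j, ignores such a scaling. The
Levi-Civita connections of the rescaled and of the pulled-back metrics are written down explicitly.
That ψ_t ∈ 𝒟(𝓕, N) follows by showing that (ψ_{-t})_*N and η(dψ_t v) do not depend on t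
(`IsFlowOf.preservesFN`). -/

noncomputable section

namespace EGF

set_option linter.unusedSectionVars false

/-! ### Mixed partials and Lie brackets in vector spaces -/

section Calculus

open Filter Topology

variable {E F : Type*} [NormedAddCommGroup E] [NormedSpace ℝ E]
  [NormedAddCommGroup F] [NormedSpace ℝ F]

/-- Mixed partial derivatives commute, for a function which is `C²` on `J × E`, where `J` is an
interval that may contain its end points. -/
theorem hasDerivWithinAt_fderiv_of_contDiffWithinAt {J : Set ℝ} (hJ : Convex ℝ J)
    (hJ' : (interior J).Nonempty) {t : ℝ} (ht : t ∈ J) {Ψ : ℝ × E → F} {x : E}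
    (hΨ : ContDiffWithinAt ℝ 2 Ψ (J ×ˢ univ) (t, x)) :
    HasDerivWithinAt (fun s => fderiv ℝ (fun y => Ψ (s, y)) x)
      (fderiv ℝ (fun y => derivWithin (fun s => Ψ (s, y)) J t) x) J t := by
  set S : Set (ℝ × E) := J ×ˢ univ with hS
  have huJ : UniqueDiffOn ℝ J := uniqueDiffOn_convex hJ hJ'
  have huS : UniqueDiffOn ℝ S := huJ.prod uniqueDiffOn_univ
  have hmem : (t, x) ∈ S := ⟨ht, mem_univ _⟩
  -- This covers the end points of J: symmetry only needs the point to lie in the closure of the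
  -- interior of S, which holds because J is convex with non-empty interior.
  have hsymm : IsSymmSndFDerivWithinAt ℝ Ψ S (t, x) := by
    refine hΨ.isSymmSndFDerivWithinAt (by simp) huS ?_ hmem
    have : S ⊆ closure (interior S) := by
      rw [hS, interior_prod_eq, closure_prod_eq, interior_univ, closure_univ]
      exact prod_mono (subset_closure.trans (Convex.closure_interior_eq_closure_of_nonempty_interior hJ hJ').ge) subset_rfl
    exact this hmem
  have hD : DifferentiableWithinAt ℝ (fderivWithin ℝ Ψ S) S (t, x) :=
    (hΨ.fderivWithin_right (m := 1) huS (by norm_num) hmem).differentiableWithinAt (by norm_num)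
  have hev : ∀ᶠ z in 𝓝[S] (t, x), DifferentiableWithinAt ℝ Ψ S z := by
    have := hΨ.eventually (by simp)
    rw [insert_eq_of_mem hmem] at this
    exact this.mono fun z hz => hz.differentiableWithinAt (by norm_num)
  have h1 : ∀ᶠ s in 𝓝[J] t, DifferentiableWithinAt ℝ Ψ S (s, x) := by
    have : Tendsto (fun s : ℝ => (s, x)) (𝓝[J] t) (𝓝[S] (t, x)) :=
      ContinuousWithinAt.tendsto_nhdsWithin (by fun_prop) fun s hs => mk_mem_prod hs (mem_univ x)
    exact this.eventually hev
  have h2 : ∀ᶠ y in 𝓝 x, DifferentiableWithinAt ℝ Ψ S (t, y) := by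
    have : Tendsto (fun y : E => (t, y)) (𝓝 x) (𝓝[S] (t, x)) :=
      tendsto_nhdsWithin_iff.2 ⟨Continuous.tendsto (by fun_prop) x,
        Eventually.of_forall fun y => ⟨ht, mem_univ _⟩⟩
    exact this.eventually hev
  -- Both partial derivatives are restrictions of the total derivative within S: to the second
  -- factor, and to the vector (1, 0).
  have e1 : ∀ s ∈ J, DifferentiableWithinAt ℝ Ψ S (s, x) →
      fderiv ℝ (fun y => Ψ (s, y)) x =
        (fderivWithin ℝ Ψ S (s, x)).comp (ContinuousLinearMap.inr ℝ ℝ E) := by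
    intro s hs h
    have := h.hasFDerivWithinAt.comp x
      ((hasFDerivAt_prodMk_right s x).hasFDerivWithinAt (s := univ))
      (fun y _ => mk_mem_prod hs (mem_univ y))
    exact (hasFDerivWithinAt_univ.1 this).fderiv
  have e2 : ∀ y, DifferentiableWithinAt ℝ Ψ S (t, y) →
      derivWithin (fun s => Ψ (s, y)) J t = fderivWithin ℝ Ψ S (t, y) (1, 0) := by
    intro y h
    have := h.hasFDerivWithinAt.comp t
      ((hasFDerivAt_prodMk_left t y).hasFDerivWithinAt (s := J))
      (fun s hs => mk_mem_prod hs (mem_univ y))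
    simpa [Function.comp_def] using this.hasDerivWithinAt.derivWithin (huJ t ht)
  have d1 : HasDerivWithinAt (fun s => fderivWithin ℝ Ψ S (s, x))
      (fderivWithin ℝ (fderivWithin ℝ Ψ S) S (t, x) (1, 0)) J t := by
    have := hD.hasFDerivWithinAt.comp t
      ((hasFDerivAt_prodMk_left t x).hasFDerivWithinAt (s := J))
      (fun s hs => mk_mem_prod hs (mem_univ x))
    simpa [Function.comp_def] using! this.hasDerivWithinAt
  have d2 : HasFDerivAt (fun y => fderivWithin ℝ Ψ S (t, y))
      ((fderivWithin ℝ (fderivWithin ℝ Ψ S) S (t, x)).comp (ContinuousLinearMap.inr ℝ ℝ E)) x := by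
    have := hD.hasFDerivWithinAt.comp x
      ((hasFDerivAt_prodMk_right t x).hasFDerivWithinAt (s := univ))
      (fun y _ => mk_mem_prod ht (mem_univ y))
    exact hasFDerivWithinAt_univ.1 this
  have d2' := (d2.clm_apply (hasFDerivAt_const ((1 : ℝ), (0 : E)) x)).congr_of_eventuallyEq
    (h2.mono fun y hy => e2 y hy)
  have key : fderiv ℝ (fun y => derivWithin (fun s => Ψ (s, y)) J t) x =
      ((fderivWithin ℝ (fderivWithin ℝ Ψ S) S (t, x)) (1, 0)).comp
        (ContinuousLinearMap.inr ℝ ℝ E) := by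
    rw [d2'.fderiv]
    ext v
    simpa using hsymm (0, v) (1, 0)
  rw [key]
  have d1' := d1.clm_comp (hasDerivWithinAt_const t J (ContinuousLinearMap.inr ℝ ℝ E))
  simp only [ContinuousLinearMap.comp_zero, add_zero] at d1'
  refine d1'.congr_of_eventuallyEq ?_ (e1 t ht (hev.self_of_nhdsWithin hmem))
  filter_upwards [h1, self_mem_nhdsWithin] with s hs hsJ using e1 s hsJ hs

/-- The Lie bracket as a commutator of derivations, in a vector space. -/
theorem fderiv_lieBracket {U : E → F} {V W : E → E} {x : E} (hU : ContDiffAt ℝ 2 U x)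
    (hV : DifferentiableAt ℝ V x) (hW : DifferentiableAt ℝ W x) :
    fderiv ℝ U x (VectorField.lieBracket ℝ V W x) =
      fderiv ℝ (fun y => fderiv ℝ U y (W y)) x (V x) -
        fderiv ℝ (fun y => fderiv ℝ U y (V y)) x (W x) := by
  have hU2 : DifferentiableAt ℝ (fderiv ℝ U) x :=
    (hU.fderiv_right (m := 1) (by norm_num)).differentiableAt (by norm_num)
  have hs : IsSymmSndFDerivAt ℝ U x := hU.isSymmSndFDerivAt (by simp)
  -- The two terms containing the second derivative of U cancel by symmetry.
  rw [fderiv_clm_apply hU2 hV, fderiv_clm_apply hU2 hW, VectorField.lieBracket_eq]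
  simp [hs.eq (V x) (W x)]

end Calculus

/-! ### Derivatives and Lie brackets read in a chart -/

section Manifold

open Filter Topology VectorField

variable {E : Type*} [NormedAddCommGroup E] [NormedSpace ℝ E] [CompleteSpace E]
  {H : Type*} [TopologicalSpace H] {I : ModelWithCorners ℝ E H} [I.Boundaryless]
  {M : Type*} [TopologicalSpace M] [ChartedSpace H M] [IsManifold I ∞ M]
  {F : Type*} [NormedAddCommGroup F] [NormedSpace ℝ F]

omit [CompleteSpace E] [IsManifold I ∞ M] in
theorem mvfderiv_eq_fderiv {u : M → F} {p : M} (hu : MDifferentiableAt I 𝓘(ℝ, F) u p) :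
    mvfderiv I u p = fderiv ℝ (u ∘ (extChartAt I p).symm) (extChartAt I p p) := by
  rw [hu.mvfderiv, I.range_eq_univ, fderivWithin_univ]
  rfl

omit [CompleteSpace E] in
theorem mvfderiv_comp_extChartAt {h : E → F} {p : M}
    (hh : DifferentiableAt ℝ h (extChartAt I p p)) :
    mvfderiv I (fun q => h (extChartAt I p q)) p = fderiv ℝ h (extChartAt I p p) := by
  have hc : MDifferentiableAt I 𝓘(ℝ, F) (fun q => h (extChartAt I p q)) p :=
    hh.mdifferentiableAt.comp p (mdifferentiableAt_extChartAt (mem_chart_source H p))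
  rw [mvfderiv_eq_fderiv hc]
  apply Filter.EventuallyEq.fderiv_eq
  filter_upwards [extChartAt_target_mem_nhds (I := I) p] with x hx
  exact congrArg h ((extChartAt I p).right_inv hx)

omit [CompleteSpace E] in
/-- The derivative of a function along a vector field, in a chart. -/
theorem mvfderiv_apply_extChartAt_symm {u : M → F} {p : M} {x : E}
    (hx : x ∈ (extChartAt I p).target)
    (hu : MDifferentiableAt I 𝓘(ℝ, F) u ((extChartAt I p).symm x))
    (X : (q : M) → TangentSpace I q) :
    mvfderiv I u ((extChartAt I p).symm x) (X ((extChartAt I p).symm x)) =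
      fderiv ℝ (u ∘ (extChartAt I p).symm) x
        (mpullbackWithin 𝓘(ℝ, E) I (extChartAt I p).symm X (range I) x) := by
  have hinv := isInvertible_mfderivWithin_extChartAt_symm (I := I) hx
  have hd := mdifferentiableWithinAt_extChartAt_symm (I := I) hx
  rw [mpullbackWithin_apply]
  rw [I.range_eq_univ, mdifferentiableWithinAt_univ] at hd
  rw [I.range_eq_univ, mfderivWithin_univ] at hinv ⊢
  have h1 : fderiv ℝ (u ∘ (extChartAt I p).symm) x =
      (mvfderiv I u ((extChartAt I p).symm x)).comp
        (mfderiv 𝓘(ℝ, E) I (extChartAt I p).symm x) := by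
    rw [← mfderiv_eq_fderiv]
    exact mfderiv_comp x hu hd
  obtain ⟨L, hL⟩ := hinv
  rw [h1, ← hL, ContinuousLinearMap.inverse_equiv]
  exact congrArg (mvfderiv I u _) (L.apply_symm_apply _).symm

-- The tangent space at p is identified with E through the chart at p itself, so the differential of
-- that chart at p is the identity.
omit [CompleteSpace E] [I.Boundaryless] in
theorem mpullbackWithin_extChartAt_symm_self (p : M) (X : (q : M) → TangentSpace I q) :
    mpullbackWithin 𝓘(ℝ, E) I (extChartAt I p).symm X (range I) (extChartAt I p p) = X p := by
  have h := (eventuallyEq_mpullback_mpullbackWithin_extChartAt (I := I) (s := univ)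
    X).self_of_nhdsWithin (mem_univ p)
  rw [mpullback_apply, mfderiv_extChartAt_self] at h
  rw [h]
  exact (congrArg (fun L : E →L[ℝ] E => L _) ContinuousLinearMap.inverse_id).symm

theorem differentiableAt_mpullbackWithin_extChartAt_symm {p : M} {Z : (q : M) → TangentSpace I q}
    (hZ : MDifferentiableAt I I.tangent (fun q => (⟨q, Z q⟩ : TangentBundle I M)) p) :
    DifferentiableAt ℝ (mpullbackWithin 𝓘(ℝ, E) I (extChartAt I p).symm Z (range I))
      (extChartAt I p p) := by
  have := (mdifferentiableWithinAt_univ.2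
    hZ).differentiableWithinAt_mpullbackWithin_vectorField
  rw [preimage_univ, univ_inter] at this
  exact this.differentiableAt (by simp [I.range_eq_univ])

omit [CompleteSpace E] [IsManifold I ∞ M] in
theorem contDiffAt_comp_extChartAt_symm {u : M → F} {p : M} {k : WithTop ℕ∞}
    (hu : ContMDiffAt I 𝓘(ℝ, F) k u p) :
    ContDiffAt ℝ k (u ∘ (extChartAt I p).symm) (extChartAt I p p) := by
  have := (contMDiffAt_iff.1 hu).2
  rw [I.range_eq_univ] at this
  exact this

-- The identity holds on a neighbourhood and not only at p, so that it can be differentiated once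
-- more.
omit [CompleteSpace E] in
theorem mvfderiv_apply_eventuallyEq {u : M → F} {p : M} (hu : ContMDiffAt I 𝓘(ℝ, F) 1 u p)
    (Z : (q : M) → TangentSpace I q) :
    (fun q => mvfderiv I u q (Z q)) =ᶠ[𝓝 p]
      fun q => (fun x => fderiv ℝ (u ∘ (extChartAt I p).symm) x
        (mpullbackWithin 𝓘(ℝ, E) I (extChartAt I p).symm Z (range I) x)) (extChartAt I p q) := by
  filter_upwards [(contMDiffAt_iff_contMDiffAt_nhds (by simp)).1 hu,
    extChartAt_source_mem_nhds (I := I) p] with q hq hqs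
  have hl := (extChartAt I p).left_inv hqs
  rw [← mvfderiv_apply_extChartAt_symm ((extChartAt I p).map_source hqs)
    (by rw [hl]; exact hq.mdifferentiableAt (by norm_num))]
  exact (congrArg (fun q => mvfderiv I u q (Z q)) hl).symm

theorem mdifferentiableAt_mvfderiv_apply {u : M → F} {p : M}
    (hu : ContMDiffAt I 𝓘(ℝ, F) 2 u p) {Y : (q : M) → TangentSpace I q}
    (hY : MDifferentiableAt I I.tangent (fun q => (⟨q, Y q⟩ : TangentBundle I M)) p) :
    MDifferentiableAt I 𝓘(ℝ, F) (fun q => mvfderiv I u q (Y q)) p := by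
  refine MDifferentiableAt.congr_of_eventuallyEq ?_
    (mvfderiv_apply_eventuallyEq (hu.of_le (by norm_num)) Y)
  have hU2 : DifferentiableAt ℝ (fderiv ℝ (u ∘ (extChartAt I p).symm)) (extChartAt I p p) :=
    ((contDiffAt_comp_extChartAt_symm hu).fderiv_right (m := 1) (by norm_num)).differentiableAt
      (by norm_num)
  exact (hU2.clm_apply
    (differentiableAt_mpullbackWithin_extChartAt_symm hY)).mdifferentiableAt.comp p
    (mdifferentiableAt_extChartAt (mem_chart_source H p))

/-- The Lie bracket as a commutator of derivations. -/
theorem mvfderiv_mlieBracket {u : M → F} {p : M} {X Y : (q : M) → TangentSpace I q}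
    (hu : ContMDiffAt I 𝓘(ℝ, F) 2 u p)
    (hX : MDifferentiableAt I I.tangent (fun q => (⟨q, X q⟩ : TangentBundle I M)) p)
    (hY : MDifferentiableAt I I.tangent (fun q => (⟨q, Y q⟩ : TangentBundle I M)) p) :
    mvfderiv I u p (mlieBracket I X Y p) =
      mvfderiv I (fun q => mvfderiv I u q (Y q)) p (X p) -
        mvfderiv I (fun q => mvfderiv I u q (X q)) p (Y p) := by
  have hdu : ∀ᶠ q in 𝓝 p, MDifferentiableAt I 𝓘(ℝ, F) u q :=
    ((contMDiffAt_iff_contMDiffAt_nhds (by simp)).1 hu).mono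
      fun q hq => hq.mdifferentiableAt (by norm_num)
  have hUc := contDiffAt_comp_extChartAt_symm hu
  have hXd := differentiableAt_mpullbackWithin_extChartAt_symm hX
  have hYd := differentiableAt_mpullbackWithin_extChartAt_symm hY
  have hU2 : DifferentiableAt ℝ (fderiv ℝ (u ∘ (extChartAt I p).symm)) (extChartAt I p p) :=
    (hUc.fderiv_right (m := 1) (by norm_num)).differentiableAt (by norm_num)
  have hbr : mlieBracket I X Y p = lieBracket ℝ
      (mpullbackWithin 𝓘(ℝ, E) I (extChartAt I p).symm X (range I))
      (mpullbackWithin 𝓘(ℝ, E) I (extChartAt I p).symm Y (range I)) (extChartAt I p p) := by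
    rw [← mlieBracketWithin_univ, mlieBracketWithin_apply, mfderiv_extChartAt_self, preimage_univ,
      univ_inter]
    refine (congrArg (fun L : E →L[ℝ] E => L _) ContinuousLinearMap.inverse_id).trans ?_
    refine lieBracketWithin_of_mem_nhds ?_
    simp [I.range_eq_univ]
  have hder : ∀ Z W : (q : M) → TangentSpace I q,
      MDifferentiableAt I I.tangent (fun q => (⟨q, Z q⟩ : TangentBundle I M)) p →
      mvfderiv I (fun q => mvfderiv I u q (Z q)) p (W p) =
        fderiv ℝ (fun x => fderiv ℝ (u ∘ (extChartAt I p).symm) x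
          (mpullbackWithin 𝓘(ℝ, E) I (extChartAt I p).symm Z (range I) x)) (extChartAt I p p)
          (W p) := by
    intro Z W hZ
    rw [mvfderiv, (mvfderiv_apply_eventuallyEq (hu.of_le (by norm_num)) Z).mfderiv_eq]
    exact congrArg (fun L : E →L[ℝ] F => L (W p))
      (mvfderiv_comp_extChartAt (I := I) 
        (hU2.clm_apply (differentiableAt_mpullbackWithin_extChartAt_symm hZ)))
  have hmain := fderiv_lieBracket hUc hXd hYd
  rw [mpullbackWithin_extChartAt_symm_self, mpullbackWithin_extChartAt_symm_self] at hmain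
  rw [hder Y X hY, hder X Y hX, mvfderiv_eq_fderiv hdu.self_of_nhds, hbr]
  exact hmain

end Manifold

/-! ### Mixed partial derivatives on a manifold -/

section Manifold

open Filter Topology VectorField

variable {E : Type*} [NormedAddCommGroup E] [NormedSpace ℝ E]
  {H : Type*} [TopologicalSpace H] {I : ModelWithCorners ℝ E H} [I.Boundaryless]
  {M : Type*} [TopologicalSpace M] [ChartedSpace H M] [IsManifold I ∞ M]
  {F : Type*} [NormedAddCommGroup F] [NormedSpace ℝ F]

/-- If u is not differentiable at p, neither is its chart expression, and both sides take the
default value 0. The formula can thus be applied to a time derivative without first proving it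
differentiable. -/
theorem mvfderiv_eq_fderiv_comp_extChartAt_symm (u : M → F) (p : M) :
    mvfderiv I u p = fderiv ℝ (u ∘ (extChartAt I p).symm) (extChartAt I p p) := by
  by_cases hu : MDifferentiableAt I 𝓘(ℝ, F) u p
  · exact mvfderiv_eq_fderiv hu
  · have hd : ¬ DifferentiableAt ℝ (u ∘ (extChartAt I p).symm) (extChartAt I p p) := by
      intro hd
      refine hu ?_
      have : MDifferentiableAt I 𝓘(ℝ, F)
          (fun q => (u ∘ (extChartAt I p).symm) (extChartAt I p q)) p :=
        hd.mdifferentiableAt.comp p (mdifferentiableAt_extChartAt (mem_chart_source H p))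
      refine this.congr_of_eventuallyEq ?_
      filter_upwards [extChartAt_source_mem_nhds (I := I) p] with q hq
      exact (congrArg u ((extChartAt I p).left_inv hq)).symm
    rw [fderiv_zero_of_not_differentiableAt hd, mvfderiv, mfderiv_zero_of_not_mdifferentiableAt hu]
    rfl

/-- Mixed partial derivatives commute, as an identity between linear maps read in the chart
at `p`. -/
theorem hasDerivWithinAt_fderiv_extChartAt_symm {J : Set ℝ} (hJ : Convex ℝ J)
    (hJ' : (interior J).Nonempty) {t : ℝ} (ht : t ∈ J) {Φ : ℝ → M → F} {p : M}
    (hΦ : ContMDiffWithinAt (𝓘(ℝ, ℝ).prod I) 𝓘(ℝ, F) 2 (fun z : ℝ × M => Φ z.1 z.2)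
      (J ×ˢ univ) (t, p)) :
    HasDerivWithinAt (fun s => fderiv ℝ (Φ s ∘ (extChartAt I p).symm) (extChartAt I p p))
      (fderiv ℝ ((fun q => derivWithin (fun s => Φ s q) J t) ∘ (extChartAt I p).symm)
        (extChartAt I p p)) J t := by
  refine hasDerivWithinAt_fderiv_of_contDiffWithinAt hJ hJ' ht
    (Ψ := fun z : ℝ × E => Φ z.1 ((extChartAt I p).symm z.2)) ?_
  rw [← contMDiffWithinAt_iff_contDiffWithinAt, modelWithCornersSelf_prod,
    ← chartedSpaceSelf_prod]
  have hs : ContMDiffAt 𝓘(ℝ, E) I 2 (extChartAt I p).symm (extChartAt I p p) := by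
    have := contMDiffWithinAt_extChartAt_symm_range (I := I) (n := 2) p
      (mem_extChartAt_target (I := I) p)
    rwa [I.range_eq_univ] at this
  have hc : ContMDiffAt (𝓘(ℝ, ℝ).prod 𝓘(ℝ, E)) (𝓘(ℝ, ℝ).prod I) 2
      (fun z : ℝ × E => (z.1, (extChartAt I p).symm z.2)) (t, extChartAt I p p) :=
    contMDiffAt_fst.prodMk (hs.comp_of_eq contMDiffAt_snd rfl)
  have := ContMDiffWithinAt.comp_of_eq (x := (t, extChartAt I p p)) (t := J ×ˢ univ)
    (g := fun z : ℝ × M => Φ z.1 z.2) (y := (t, p))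
    hΦ (hc.contMDiffWithinAt (s := J ×ˢ univ)) (fun z hz => ⟨hz.1, mem_univ _⟩) (by simp)
  exact this

/-- Mixed partial derivatives commute. -/
theorem hasDerivWithinAt_mvfderiv {J : Set ℝ} (hJ : Convex ℝ J)
    (hJ' : (interior J).Nonempty) {t : ℝ} (ht : t ∈ J) {Φ : ℝ → M → F} {p : M}
    (hΦ : ContMDiffWithinAt (𝓘(ℝ, ℝ).prod I) 𝓘(ℝ, F) 2 (fun z : ℝ × M => Φ z.1 z.2)
      (J ×ˢ univ) (t, p)) (v : TangentSpace I p) :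
    HasDerivWithinAt (fun s => mvfderiv I (Φ s) p v)
      (mvfderiv I (fun q => derivWithin (fun s => Φ s q) J t) p v) J t := by
  simp only [mvfderiv_eq_fderiv_comp_extChartAt_symm]
  let w : E := v
  have h := (hasDerivWithinAt_fderiv_extChartAt_symm hJ hJ' ht hΦ).clm_apply
    (hasDerivWithinAt_const t J w)
  rw [map_zero, add_zero] at h
  exact h

end Manifold

/-! ### Smooth (0,2)-tensor fields in coordinates -/

section TensorFields

open Filter Topology VectorField

variable {E : Type*} [NormedAddCommGroup E] [NormedSpace ℝ E]
  {H : Type*} [TopologicalSpace H] {I : ModelWithCorners ℝ E H}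
  {M : Type*} [TopologicalSpace M] [ChartedSpace H M] [IsManifold I ∞ M]

theorem inCoordinates_bilin {p q : M} (hq : q ∈ (chartAt H p).source)
    (T : TangentSpace I q →L[ℝ] TangentSpace I q →L[ℝ] ℝ) (c d : E) :
    ContinuousLinearMap.inCoordinates E (TangentSpace I) (E →L[ℝ] ℝ)
      (fun q : M => TangentSpace I q →L[ℝ] ℝ) p q p q T c d =
    T ((trivializationAt E (TangentSpace I) p).symmL ℝ q c)
      ((trivializationAt E (TangentSpace I) p).symmL ℝ q d) := by
  have hq' : q ∈ (trivializationAt E (TangentSpace I) p).baseSet := by simpa using hq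
  rw [ContinuousLinearMap.inCoordinates_eq hq' (by simpa using hq)]
  simp [hom_trivializationAt_apply, ContinuousLinearMap.inCoordinates, Trivialization.symmL_apply _ hq']

/-- On the chart domain the trivialization of the tangent bundle at p is the differential of the
chart. -/
theorem symmL_mvfderiv_extChartAt {p q : M} (hq : q ∈ (chartAt H p).source)
    (v : TangentSpace I q) :
    (trivializationAt E (TangentSpace I) p).symmL ℝ q (mvfderiv I (extChartAt I p) q v) = v := by
  have hq' : q ∈ (trivializationAt E (TangentSpace I) p).baseSet := by simpa using hq
  have key : mvfderiv I (extChartAt I p) q v =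
      (trivializationAt E (TangentSpace I) p).continuousLinearMapAt ℝ q v := by
    rw [TangentBundle.continuousLinearMapAt_trivializationAt hq]
    rfl
  rw [key, Trivialization.symmL_continuousLinearMapAt _ hq']

/-- A smooth `(0,2)`-tensor field, read in a chart. -/
theorem exists_contMDiffAt_eq_mvfderiv_extChartAt
    {T : (q : M) → TangentSpace I q →L[ℝ] TangentSpace I q →L[ℝ] ℝ} {p : M}
    (hT : ContMDiffAt I (I.prod 𝓘(ℝ, E →L[ℝ] E →L[ℝ] ℝ)) ∞
      (fun q => TotalSpace.mk' (E →L[ℝ] E →L[ℝ] ℝ)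
        (E := fun q : M => TangentSpace I q →L[ℝ] TangentSpace I q →L[ℝ] ℝ) q (T q)) p) :
    ∃ G : M → E →L[ℝ] E →L[ℝ] ℝ, ContMDiffAt I 𝓘(ℝ, E →L[ℝ] E →L[ℝ] ℝ) ∞ G p ∧
      ∀ᶠ q in 𝓝 p, ∀ v w : TangentSpace I q, T q v w =
        G q (mvfderiv I (extChartAt I p) q v) (mvfderiv I (extChartAt I p) q w) := by
  rw [contMDiffAt_hom_bundle] at hT
  refine ⟨_, hT.2, ?_⟩
  filter_upwards [(chartAt H p).open_source.mem_nhds (mem_chart_source H p)] with q hq v w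
  rw [inCoordinates_bilin hq, symmL_mvfderiv_extChartAt hq, symmL_mvfderiv_extChartAt hq]

/-- A family of bilinear forms on tangent spaces is smooth if its values on smooth vector fields
are smooth. -/
theorem contMDiffAt_bilin_of_forall [FiniteDimensional ℝ E]
    {E' : Type*} [NormedAddCommGroup E'] [NormedSpace ℝ E']
    {H' : Type*} [TopologicalSpace H'] {I' : ModelWithCorners ℝ E' H'}
    {N : Type*} [TopologicalSpace N] [ChartedSpace H' N] {b : N → M} {m : N}
    {T : (m : N) → TangentSpace I (b m) →L[ℝ] TangentSpace I (b m) →L[ℝ] ℝ}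
    (hb : ContMDiffAt I' I ∞ b m)
    (h : ∀ Y Z : (q : M) → TangentSpace I q,
      ContMDiffAt I I.tangent ∞ (fun q => (⟨q, Y q⟩ : TangentBundle I M)) (b m) →
      ContMDiffAt I I.tangent ∞ (fun q => (⟨q, Z q⟩ : TangentBundle I M)) (b m) →
      ContMDiffAt I' 𝓘(ℝ, ℝ) ∞ (fun m => T m (Y (b m)) (Z (b m))) m) :
    ContMDiffAt I' (I.prod 𝓘(ℝ, E →L[ℝ] E →L[ℝ] ℝ)) ∞
      (fun m => TotalSpace.mk' (E →L[ℝ] E →L[ℝ] ℝ)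
        (E := fun q : M => TangentSpace I q →L[ℝ] TangentSpace I q →L[ℝ] ℝ) (b m) (T m)) m := by
  rw [contMDiffAt_hom_bundle]
  refine ⟨hb, ?_⟩
  let hbas := Module.finBasis ℝ E
  let B := fun i j => ((hbas.coord i).toContinuousLinearMap).smulRight
    ((hbas.coord j).toContinuousLinearMap)
  -- Fields with constant coordinates in the trivialization serve as test fields. Smoothness is only
  -- required at one point, so no cut-off is needed.
  have hY : ∀ c : E, ContMDiffAt I I.tangent ∞ (fun q => (⟨q,
      (trivializationAt E (TangentSpace I) (b m)).symmL ℝ q c⟩ : TangentBundle I M)) (b m) := by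
    intro c
    have hm : b m ∈ (trivializationAt E (TangentSpace I) (b m)).baseSet := by simp
    have := FiberBundle.contMDiffAt_extend (k := ∞) I E (x := b m)
      ((trivializationAt E (TangentSpace I) (b m)).symmL ℝ (b m) c)
    refine this.congr_of_eventuallyEq ?_
    filter_upwards [(trivializationAt E (TangentSpace I) (b m)).open_baseSet.mem_nhds hm] with q hq
    simp [FiberBundle.extend, Trivialization.symmL_apply _ hq, Trivialization.symmL_apply _ hm,
      Trivialization.apply_mk_symm _ hm]
  have hsum : ContMDiffAt I' 𝓘(ℝ, E →L[ℝ] E →L[ℝ] ℝ) ∞ (fun x => ∑ i, ∑ j,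
      (T x ((trivializationAt E (TangentSpace I) (b m)).symmL ℝ (b x) (hbas i))
        ((trivializationAt E (TangentSpace I) (b m)).symmL ℝ (b x) (hbas j))) • B i j) m := by
    refine ContMDiffAt.sum fun i _ => ContMDiffAt.sum fun j _ => ?_
    exact (h _ _ (hY _) (hY _)).smul contMDiffAt_const
  refine hsum.congr_of_eventuallyEq ?_
  have : ∀ᶠ x in 𝓝 m, b x ∈ (chartAt H (b m)).source :=
    hb.continuousAt.eventually ((chartAt H (b m)).open_source.mem_nhds (mem_chart_source H _))
  filter_upwards [this] with x hx
  -- A bilinear form on E is determined by its finitely many matrix entries, and these are the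
  -- values on the test fields.
  have expand : ∀ L : E →L[ℝ] E →L[ℝ] ℝ, L = ∑ i, ∑ j, L (hbas i) (hbas j) • B i j := by
    intro L
    ext c d
    conv_lhs => rw [← hbas.sum_repr c, ← hbas.sum_repr d]
    simp only [map_sum, map_smul, sum_apply, smul_apply,
      smul_eq_mul, B, ContinuousLinearMap.smulRight_apply, LinearMap.coe_toContinuousLinearMap',
      Module.Basis.coord_apply, Finset.mul_sum]
    refine Finset.sum_comm.trans ?_
    refine Finset.sum_congr rfl fun i _ => Finset.sum_congr rfl fun j _ => ?_
    ring
  rw [expand (ContinuousLinearMap.inCoordinates _ _ _ _ _ _ _ _ _)]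
  refine Finset.sum_congr rfl fun i _ => Finset.sum_congr rfl fun j _ => ?_
  rw [inCoordinates_bilin hx]

end TensorFields

/-! ### Families of maps through the identity and Lie derivatives -/

section Variation

open Filter Topology VectorField

variable {E : Type*} [NormedAddCommGroup E] [NormedSpace ℝ E] [CompleteSpace E]
  {H : Type*} [TopologicalSpace H] {I : ModelWithCorners ℝ E H} [I.Boundaryless]
  {M : Type*} [TopologicalSpace M] [ChartedSpace H M] [IsManifold I ∞ M]
  {F : Type*} [NormedAddCommGroup F] [NormedSpace ℝ F]

theorem two_le_infty : (2 : WithTop ℕ∞) ≤ ∞ := by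
  exact WithTop.coe_le_coe.2 (le_top : (2 : ℕ∞) ≤ ⊤)

omit [CompleteSpace E] [I.Boundaryless] [IsManifold I ∞ M] in
theorem mvfderiv_congr {u u' : M → F} {p : M} (h : u =ᶠ[𝓝 p] u') :
    mvfderiv I u p = mvfderiv I u' p :=
  h.mfderiv_eq

variable (I) in
/-- A smooth family `φ s`, `s ∈ J`, of maps with `φ 0 = id`, whose velocity at `s = 0` is the
vector field `X`. -/
structure IsVariation (J : Set ℝ) (φ : ℝ → M → M) (X : (q : M) → TangentSpace I q) : Prop where
  convex : Convex ℝ J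
  interior_nonempty : (interior J).Nonempty
  zero_mem : (0 : ℝ) ∈ J
  smooth : ContMDiffOn (𝓘(ℝ, ℝ).prod I) I ∞ (fun z : ℝ × M => φ z.1 z.2) (J ×ˢ univ)
  init : ∀ q, φ 0 q = q
  velocity : ∀ q, HasMFDerivWithinAt 𝓘(ℝ, ℝ) I (fun s => φ s q) J 0
    ((1 : ℝ →L[ℝ] ℝ).smulRight (X (φ 0 q)))

namespace IsVariation

variable {J : Set ℝ} {φ : ℝ → M → M} {X : (q : M) → TangentSpace I q}

omit [CompleteSpace E] [I.Boundaryless] [IsManifold I ∞ M] in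
theorem uniqueDiffWithinAt (h : IsVariation I J φ X) : UniqueDiffWithinAt ℝ J 0 :=
  uniqueDiffOn_convex h.convex h.interior_nonempty 0 h.zero_mem

omit [CompleteSpace E] [I.Boundaryless] [IsManifold I ∞ M] in
theorem contMDiff (h : IsVariation I J φ X) {s : ℝ} (hs : s ∈ J) : ContMDiff I I ∞ (φ s) := by
  rw [← contMDiffOn_univ]
  exact h.smooth.comp (t := J ×ˢ univ) (f := fun q : M => ((s, q) : ℝ × M))
    (contMDiff_const.prodMk contMDiff_id).contMDiffOn (fun q _ => ⟨hs, mem_univ q⟩)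

omit [CompleteSpace E] [I.Boundaryless] [IsManifold I ∞ M] in
theorem tendsto (h : IsVariation I J φ X) (p : M) :
    Tendsto (fun s => φ s p) (𝓝[J] 0) (𝓝 p) := by
  have := (h.velocity p).1.tendsto
  simpa only [h.init] using this

omit [CompleteSpace E] [I.Boundaryless] [IsManifold I ∞ M] in
theorem hasDerivWithinAt (h : IsVariation I J φ X) {u : M → F} {q : M}
    (hu : MDifferentiableAt I 𝓘(ℝ, F) u q) :
    HasDerivWithinAt (fun s => u (φ s q)) (mvfderiv I u q (X q)) J 0 := by
  have hu' : MDifferentiableAt I 𝓘(ℝ, F) u (φ 0 q) := by rwa [h.init]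
  have := hu'.hasMFDerivAt.comp_hasMFDerivWithinAt 0 (h.velocity q)
  have h2 : HasFDerivWithinAt (fun s => u (φ s q))
      ((mvfderiv I u (φ 0 q)).comp ((1 : ℝ →L[ℝ] ℝ).smulRight (X (φ 0 q)))) J 0 :=
    hasMFDerivWithinAt_iff_hasFDerivWithinAt.1 this
  have h3 : mvfderiv I u q (X q) = mvfderiv I u (φ 0 q) (X (φ 0 q)) := by
    rw [h.init]
  rw [h3]
  simpa using h2.hasDerivWithinAt

omit [CompleteSpace E] [I.Boundaryless] [IsManifold I ∞ M] in
theorem contMDiffWithinAt_comp (h : IsVariation I J φ X) {u : M → F} {p : M}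
    (hu : ContMDiffAt I 𝓘(ℝ, F) ∞ u p) :
    ContMDiffWithinAt (𝓘(ℝ, ℝ).prod I) 𝓘(ℝ, F) ∞ (fun z : ℝ × M => u (φ z.1 z.2))
      (J ×ˢ univ) (0, p) :=
  ContMDiffAt.comp_contMDiffWithinAt_of_eq (x := ((0, p) : ℝ × M)) hu
    (h.smooth (0, p) ⟨h.zero_mem, mem_univ p⟩) (h.init p)

omit [CompleteSpace E] [I.Boundaryless] [IsManifold I ∞ M] in
theorem mvfderiv_comp (h : IsVariation I J φ X) {u : M → F} {p : M} {s : ℝ} (hs : s ∈ J)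
    (hu : MDifferentiableAt I 𝓘(ℝ, F) u (φ s p)) (v : TangentSpace I p) :
    mvfderiv I (fun q => u (φ s q)) p v =
      mvfderiv I u (φ s p) (mfderiv I I (φ s) p v) :=
  mfderiv_comp_apply p hu ((h.contMDiff hs).mdifferentiableAt (by simp)) v

omit [CompleteSpace E] [I.Boundaryless] in
theorem eventually_mdifferentiableAt (h : IsVariation I J φ X) {u : M → F} {p : M}
    (hu : ContMDiffAt I 𝓘(ℝ, F) ∞ u p) :
    ∀ᶠ s in 𝓝[J] 0, MDifferentiableAt I 𝓘(ℝ, F) u (φ s p) :=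
  (h.tendsto p).eventually (((contMDiffAt_iff_contMDiffAt_nhds (n := 1) (by simp)).1
    (hu.of_le (by simp))).mono fun q hq => hq.mdifferentiableAt (by norm_num))

omit [CompleteSpace E] [I.Boundaryless] in
theorem derivWithin_eventuallyEq (h : IsVariation I J φ X) {u : M → F} {p : M}
    (hu : ContMDiffAt I 𝓘(ℝ, F) ∞ u p) :
    (fun q => derivWithin (fun s => u (φ s q)) J 0) =ᶠ[𝓝 p] fun q => mvfderiv I u q (X q) := by
  filter_upwards [(contMDiffAt_iff_contMDiffAt_nhds (n := 1) (by simp)).1 (hu.of_le (by simp))]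
    with q hq
  exact (h.hasDerivWithinAt (hq.mdifferentiableAt (by norm_num))).derivWithin h.uniqueDiffWithinAt

omit [CompleteSpace E] in
/-- The derivative at `s = 0` of the differentials of `φ s`. -/
theorem hasDerivWithinAt_mfderiv (h : IsVariation I J φ X) {u : M → F} {p : M}
    (hu : ContMDiffAt I 𝓘(ℝ, F) ∞ u p) (v : TangentSpace I p) :
    HasDerivWithinAt (fun s => mvfderiv I u (φ s p) (mfderiv I I (φ s) p v))
      (mvfderiv I (fun q => mvfderiv I u q (X q)) p v) J 0 := by
  -- Exchange ∂_s with the derivative along v in u(φ_s q); the inner ∂_s at s = 0 is Xu.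
  have h1 := hasDerivWithinAt_mvfderiv h.convex h.interior_nonempty h.zero_mem
    (Φ := fun s q => u (φ s q)) ((h.contMDiffWithinAt_comp hu).of_le two_le_infty) v
  have h2 : mvfderiv I (fun q => derivWithin (fun s => u (φ s q)) J 0) p =
      mvfderiv I (fun q => mvfderiv I u q (X q)) p :=
    mvfderiv_congr (h.derivWithin_eventuallyEq hu)
  rw [h2] at h1
  refine h1.congr_of_eventuallyEq_of_mem ?_ h.zero_mem
  filter_upwards [h.eventually_mdifferentiableAt hu, self_mem_nhdsWithin] with s hs hsJ
  exact (h.mvfderiv_comp hsJ hs v).symm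

/-- Since Y(Xu) = X(Yu) − [X,Y]u, the derivative of du(dφ_s Y) differs from that of du(Y) along s ↦
φ_s p by exactly the bracket term of the Lie derivative. -/
theorem hasDerivWithinAt_mfderiv_sub (h : IsVariation I J φ X) {u : M → F} {p : M}
    (hu : ContMDiffAt I 𝓘(ℝ, F) ∞ u p)
    (hX : MDifferentiableAt I I.tangent (fun q => (⟨q, X q⟩ : TangentBundle I M)) p)
    {Y : (q : M) → TangentSpace I q}
    (hY : MDifferentiableAt I I.tangent (fun q => (⟨q, Y q⟩ : TangentBundle I M)) p) :
    HasDerivWithinAt (fun s => mvfderiv I u (φ s p) (mfderiv I I (φ s) p (Y p)))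
      (mvfderiv I (fun q => mvfderiv I u q (Y q)) p (X p) -
        mvfderiv I u p (mlieBracket I X Y p)) J 0 := by
  rw [mvfderiv_mlieBracket (hu.of_le two_le_infty) hX hY, sub_sub_cancel]
  exact h.hasDerivWithinAt_mfderiv hu (Y p)

/-- The derivative at `s = 0` of the pull-backs of a `(0,2)`-tensor field is its Lie derivative. -/
theorem hasDerivWithinAt_pullback (h : IsVariation I J φ X)
    {T : (q : M) → TangentSpace I q →L[ℝ] TangentSpace I q →L[ℝ] ℝ} {p : M}
    (hT : ContMDiffAt I (I.prod 𝓘(ℝ, E →L[ℝ] E →L[ℝ] ℝ)) ∞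
      (fun q => TotalSpace.mk' (E →L[ℝ] E →L[ℝ] ℝ)
        (E := fun q : M => TangentSpace I q →L[ℝ] TangentSpace I q →L[ℝ] ℝ) q (T q)) p)
    (hX : MDifferentiableAt I I.tangent (fun q => (⟨q, X q⟩ : TangentBundle I M)) p)
    {Y Z : (q : M) → TangentSpace I q}
    (hY : MDifferentiableAt I I.tangent (fun q => (⟨q, Y q⟩ : TangentBundle I M)) p)
    (hZ : MDifferentiableAt I I.tangent (fun q => (⟨q, Z q⟩ : TangentBundle I M)) p) :
    HasDerivWithinAt
      (fun s => T (φ s p) (mfderiv I I (φ s) p (Y p)) (mfderiv I I (φ s) p (Z p)))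
      (mvfderiv I (fun q => T q (Y q) (Z q)) p (X p) - T p (mlieBracket I X Y p) (Z p) -
        T p (Y p) (mlieBracket I X Z p)) J 0 := by
  -- Writing T = G(du·, du·), with G and du(·) valued in fixed vector spaces, turns the pull-back
  -- into a product of three curves, to which the Leibniz rule applies.
  obtain ⟨G, hG, hGT⟩ := exists_contMDiffAt_eq_mvfderiv_extChartAt hT
  have hu : ContMDiffAt I 𝓘(ℝ, E) ∞ (extChartAt I p) p := contMDiffAt_extChartAt
  have hGd := hG.mdifferentiableAt (by simp)
  set u := extChartAt I p with hudef
  have hp : ∀ v w : TangentSpace I p, T p v w = G p (mvfderiv I u p v) (mvfderiv I u p w) :=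
    hGT.self_of_nhds
  have hφp : ∀ v : TangentSpace I p,
      mvfderiv I u (φ 0 p) (mfderiv I I (φ 0) p v) = mvfderiv I u p v := by
    intro v
    rw [← h.mvfderiv_comp h.zero_mem (by rw [h.init]; exact hu.mdifferentiableAt (by simp))]
    simp only [h.init]
  -- the derivative of the function `T Y Z` along `X`
  have hYu := mdifferentiableAt_mvfderiv_apply (hu.of_le two_le_infty) hY
  have hZu := mdifferentiableAt_mvfderiv_apply (hu.of_le two_le_infty) hZ
  have d1 := (((h.hasDerivWithinAt hGd).clm_apply (h.hasDerivWithinAt hYu)).clm_apply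
    (h.hasDerivWithinAt hZu))
  have hval : ∀ W : (q : M) → TangentSpace I q,
      mvfderiv I u (φ 0 p) (W (φ 0 p)) = mvfderiv I u p (W p) := by
    intro W
    rw [h.init]
  simp only [h.init, hval] at d1
  have hTd : MDifferentiableAt I 𝓘(ℝ, ℝ) (fun q => T q (Y q) (Z q)) p := by
    have h1 := (hT.mdifferentiableAt (by simp)).clm_bundle_apply₂ (F₃ := ℝ) hY hZ
    rw [mdifferentiableAt_totalSpace] at h1
    exact h1.2
  have d2 := h.hasDerivWithinAt hTd
  have d3 := (((h.hasDerivWithinAt hGd).clm_apply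
    (h.hasDerivWithinAt_mfderiv_sub hu hX hY)).clm_apply
    (h.hasDerivWithinAt_mfderiv_sub hu hX hZ))
  simp only [h.init, hφp] at d3
  -- Here `d1` expands X(T(Y,Z)), with Y and Z evaluated along s ↦ φ_s p, while `d3` has them
  -- transported by dφ_s. The two results differ only by the bracket terms.
  have e2 := h.uniqueDiffWithinAt.eq_deriv _ (d2.congr_of_eventuallyEq_of_mem
    (((h.tendsto p).eventually hGT).mono fun s hs => (hs _ _).symm) h.zero_mem) d1
  rw [e2, hp, hp]
  refine (d3.congr_of_eventuallyEq_of_mem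
    (((h.tendsto p).eventually hGT).mono fun s hs => hs _ _) h.zero_mem).congr_deriv ?_
  simp only [map_sub, sub_apply, add_apply]
  ring

/-- If the vector fields `X` and `N` commute at `p`, the pull-backs of `N` by `φ s` are stationary
at `s = 0`. -/
theorem hasDerivWithinAt_zero_of_mlieBracket_eq_zero (h : IsVariation I J φ X) {p : M}
    (hX : MDifferentiableAt I I.tangent (fun q => (⟨q, X q⟩ : TangentBundle I M)) p)
    {N : (q : M) → TangentSpace I q}
    (hN : MDifferentiableAt I I.tangent (fun q => (⟨q, N q⟩ : TangentBundle I M)) p)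
    (hXN : mlieBracket I X N p = 0) {w : ℝ → E}
    (hw : ∀ᶠ s in 𝓝[J] 0, mfderiv I I (φ s) p (w s) = N (φ s p)) :
    HasDerivWithinAt w 0 J 0 := by
  have hu : ContMDiffAt I 𝓘(ℝ, E) ∞ (extChartAt I p) p := contMDiffAt_extChartAt
  set u := extChartAt I p with hudef
  -- A s represents dφ_s at p in the chart u: a curve of endomorphisms of E starting at the
  -- identity.
  set A : ℝ → E →L[ℝ] E := fun s => fderiv ℝ ((fun q => u (φ s q)) ∘ u.symm) (u p) with hA
  have hAv : ∀ s ∈ J, MDifferentiableAt I 𝓘(ℝ, E) u (φ s p) → ∀ v : E,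
      A s v = mvfderiv I u (φ s p) (mfderiv I I (φ s) p v) := by
    intro s hs hus v
    exact (congrArg (fun L : E →L[ℝ] E => L v) (mvfderiv_eq_fderiv_comp_extChartAt_symm
      (I := I) (fun q => u (φ s q)) p)).symm.trans (h.mvfderiv_comp hs hus v)
  have hA0 : A 0 = 1 := by
    ext v
    have : mvfderiv I u p v = v :=
      congrArg (fun L : E →L[ℝ] E => L v) (mfderiv_extChartAt_self (I := I) (x := p))
    rw [mvfderiv_eq_fderiv_comp_extChartAt_symm] at this
    simpa only [hA, h.init] using! this
  have hA' := hasDerivWithinAt_fderiv_extChartAt_symm h.convex h.interior_nonempty h.zero_mem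
    (Φ := fun s q => u (φ s q)) ((h.contMDiffWithinAt_comp hu).of_le two_le_infty)
  set A' : E →L[ℝ] E := fderiv ℝ ((fun q => derivWithin (fun s => u (φ s q)) J 0) ∘ u.symm) (u p)
    with hA'def
  have hA'v : ∀ v : E, A' v = mvfderiv I (fun q => mvfderiv I u q (X q)) p v := by
    intro v
    rw [hA'def, ← mvfderiv_eq_fderiv_comp_extChartAt_symm]
    exact congrArg (fun L : E →L[ℝ] E => L v) (mvfderiv_congr (h.derivWithin_eventuallyEq hu))
  have hν := h.hasDerivWithinAt (mdifferentiableAt_mvfderiv_apply (hu.of_le two_le_infty) hN)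
  -- No regularity of w is assumed. It comes from w = A⁻¹ du(N(φ_s p)) near s = 0, where A s is
  -- invertible because A 0 = 1.
  have hinv : HasDerivWithinAt (fun s => Ring.inverse (A s)) (-A') J 0 := by
    have h1 := hasFDerivAt_ringInverse (𝕜 := ℝ) (1 : (E →L[ℝ] E)ˣ)
    rw [Units.val_one, inv_one, Units.val_one] at h1
    rw [← hA0] at h1
    have h2 := h1.comp_hasDerivWithinAt 0 hA'
    refine h2.congr_deriv ?_
    rw [hA0]
    exact congrArg Neg.neg ((mul_one _).trans (one_mul _))
  have hunit : ∀ᶠ s in 𝓝[J] 0, IsUnit (A s) := by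
    have : Tendsto A (𝓝[J] 0) (𝓝 1) := hA0 ▸ hA'.continuousWithinAt.tendsto
    exact this.eventually (Units.isOpen.mem_nhds isUnit_one)
  have hweq : w =ᶠ[𝓝[J] 0] fun s => Ring.inverse (A s) (mvfderiv I u (φ s p) (N (φ s p))) := by
    filter_upwards [hw, hunit, h.eventually_mdifferentiableAt hu, self_mem_nhdsWithin]
      with s hs hsu hsd hsJ
    rw [← hs, ← hAv s hsJ hsd]
    have := Ring.inverse_mul_cancel _ hsu
    exact (congrArg (fun L : E →L[ℝ] E => L (w s)) this).symm
  refine ((hinv.clm_apply hν).congr_of_eventuallyEq_of_mem hweq h.zero_mem).congr_deriv ?_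
  have hNp : mvfderiv I u (φ 0 p) (N (φ 0 p)) = N p := by
    rw [h.init]
    exact congrArg (fun L : E →L[ℝ] E => L (N p)) (mfderiv_extChartAt_self (I := I) (x := p))
  have hb := mvfderiv_mlieBracket (hu.of_le two_le_infty) hX hN
  rw [hXN, map_zero] at hb
  rw [hNp, hA0, Ring.inverse_one]
  have hc := hA'v (N p)
  -- The derivative of w is −N(Xu) + X(Nu) = [X,N]u, which vanishes.
  exact (congrArg₂ (fun a b : E => -a + b) hc rfl).trans
    ((neg_add_eq_sub _ _).trans hb.symm)

end IsVariation

end Variation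

/-! ### The splitting of TM and the truncated metric -/

section Foliation

open Filter Topology VectorField

variable {n : ℕ} {M : Type*} [TopologicalSpace M]
  [ChartedSpace (EuclideanSpace ℝ (Fin (n + 1))) M] [IsManifold (𝓡 (n + 1)) ∞ M]
  {𝓕 : OrientedFoliation n M} {g g' : Metric n M} {p : M}

/-- Differentiability of a vector field at a point. -/
abbrev MDiffField (Y : VectorField n M) (p : M) : Prop :=
  MDifferentiableAt (𝓡 (n + 1)) (𝓡 (n + 1)).tangent
    (fun q => (⟨q, Y q⟩ : TangentBundle (𝓡 (n + 1)) M)) p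

theorem SmoothField.mDiffField {Y : VectorField n M} (hY : SmoothField Y) (p : M) :
    MDiffField Y p :=
  hY.mdifferentiableAt (by simp)

theorem mdifferentiableAt_bilin
    {T : (q : M) → TangentSpace (𝓡 (n + 1)) q →L[ℝ] TangentSpace (𝓡 (n + 1)) q →L[ℝ] ℝ}
    (hT : ContMDiffAt (𝓡 (n + 1)) ((𝓡 (n + 1)).prod 𝓘(ℝ, EuclideanSpace ℝ (Fin (n + 1)) →L[ℝ]
      EuclideanSpace ℝ (Fin (n + 1)) →L[ℝ] ℝ)) ∞
      (fun q => TotalSpace.mk' (EuclideanSpace ℝ (Fin (n + 1)) →L[ℝ]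
        EuclideanSpace ℝ (Fin (n + 1)) →L[ℝ] ℝ)
        (E := fun q : M => TangentSpace (𝓡 (n + 1)) q →L[ℝ] TangentSpace (𝓡 (n + 1)) q →L[ℝ] ℝ)
        q (T q)) p)
    {Y Z : VectorField n M} (hY : MDiffField Y p) (hZ : MDiffField Z p) :
    MDifferentiableAt (𝓡 (n + 1)) 𝓘(ℝ, ℝ) (fun q => T q (Y q) (Z q)) p := by
  have h := (hT.mdifferentiableAt (by simp)).clm_bundle_apply₂ (F₃ := ℝ) hY hZ
  rw [mdifferentiableAt_totalSpace] at h
  exact h.2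

theorem mdifferentiableAt_inner (g : Metric n M) {Y Z : VectorField n M} (hY : MDiffField Y p)
    (hZ : MDiffField Z p) :
    MDifferentiableAt (𝓡 (n + 1)) 𝓘(ℝ, ℝ) (fun q => g.inner q (Y q) (Z q)) p :=
  mdifferentiableAt_bilin (g.contMDiff p) hY hZ

theorem contMDiffAt_inner (g : Metric n M) {Y Z : VectorField n M}
    (hY : ContMDiffAt (𝓡 (n + 1)) (𝓡 (n + 1)).tangent ∞
      (fun q => (⟨q, Y q⟩ : TangentBundle (𝓡 (n + 1)) M)) p)
    (hZ : ContMDiffAt (𝓡 (n + 1)) (𝓡 (n + 1)).tangent ∞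
      (fun q => (⟨q, Z q⟩ : TangentBundle (𝓡 (n + 1)) M)) p) :
    ContMDiffAt (𝓡 (n + 1)) 𝓘(ℝ, ℝ) ∞ (fun q => g.inner q (Y q) (Z q)) p := by
  have h := (g.contMDiff p).clm_bundle_apply₂ (F₃ := ℝ) hY hZ
  rw [contMDiffAt_totalSpace] at h
  exact h.2

/-- A local extension of v is cut off by a bump function; the Hausdorff property makes the bump
function globally smooth. -/
theorem exists_smoothField [T2Space M] (p : M) (v : TangentSpace (𝓡 (n + 1)) p) :
    ∃ Y : VectorField n M, SmoothField Y ∧ Y p = v := by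
  obtain ⟨s, hs, hsm⟩ := FiberBundle.exists_contMDiffOn_extend (k := ∞) (𝓡 (n + 1))
    (EuclideanSpace ℝ (Fin (n + 1))) (x₀ := p) v
  obtain ⟨u, hus, huo, hpu⟩ := mem_nhds_iff.1 hs
  obtain ⟨ρ, -, hρ⟩ := (SmoothBumpFunction.nhds_basis_tsupport (I := 𝓡 (n + 1)) p).mem_iff.1
    (huo.mem_nhds hpu)
  refine ⟨_, ContMDiffOn.smul_section_of_tsupport (n := ∞) (u := u) (ψ := ρ)
    ρ.contMDiff.contMDiffOn huo hρ (hsm.mono hus), ?_⟩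
  change ρ p • FiberBundle.extend _ v p = v
  rw [ρ.eq_one, one_smul, FiberBundle.extend_apply_self]

/-- T𝓕 is the kernel of du for a local submersion u, and du(N) ≠ 0. No metric enters the
coefficient. -/
theorem exists_sub_smul_normal_mem (𝓕 : OrientedFoliation n M) (p : M)
    (v : TangentSpace (𝓡 (n + 1)) p) : ∃ c : ℝ, v - c • 𝓕.normal p ∈ 𝓕.tangent p := by
  obtain ⟨U, -, hpU, u, -, hu⟩ := 𝓕.locally_submersion p
  obtain ⟨-, hu⟩ := hu p hpU
  have hN : mvfderiv (𝓡 (n + 1)) u p (𝓕.normal p) ≠ 0 := fun h =>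
    𝓕.transversal p ((hu _).2 h)
  refine ⟨mvfderiv (𝓡 (n + 1)) u p v / mvfderiv (𝓡 (n + 1)) u p (𝓕.normal p), (hu _).2 ?_⟩
  rw [map_sub, map_smul, smul_eq_mul, div_mul_cancel₀ _ hN, sub_self]

theorem IsAdapted.inner_normal_eq_of_mem (h : IsAdapted 𝓕 g) {v : TangentSpace (𝓡 (n + 1)) p}
    {c : ℝ} (hc : v - c • 𝓕.normal p ∈ 𝓕.tangent p) : g.inner p v (𝓕.normal p) = c := by
  have := (h p).2 _ hc
  rw [map_sub, map_smul, sub_apply, smul_apply, (h p).1, smul_eq_mul, mul_one, sub_eq_zero] at this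
  exact this

theorem IsAdapted.mem_tangent_iff (h : IsAdapted 𝓕 g) {v : TangentSpace (𝓡 (n + 1)) p} :
    v ∈ 𝓕.tangent p ↔ g.inner p v (𝓕.normal p) = 0 := by
  refine ⟨(h p).2 v, fun hv => ?_⟩
  obtain ⟨c, hc⟩ := exists_sub_smul_normal_mem 𝓕 p v
  rw [h.inner_normal_eq_of_mem hc] at hv
  rwa [hv, zero_smul, sub_zero] at hc

/-- Both sides are the N-component of v in the metric-free splitting of the tangent space. Hence the
form g(·,N) is constant along the flow. -/
theorem IsAdapted.inner_normal_eq (h : IsAdapted 𝓕 g) (h' : IsAdapted 𝓕 g')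
    (v : TangentSpace (𝓡 (n + 1)) p) :
    g.inner p v (𝓕.normal p) = g'.inner p v (𝓕.normal p) := by
  obtain ⟨c, hc⟩ := exists_sub_smul_normal_mem 𝓕 p v
  rw [h.inner_normal_eq_of_mem hc, h'.inner_normal_eq_of_mem hc]

theorem hat_apply (v : TangentSpace (𝓡 (n + 1)) p) :
    hat 𝓕 g p v = v - g.inner p v (𝓕.normal p) • 𝓕.normal p := by
  rw [g.symm p v]
  rfl

theorem IsAdapted.inner_hat_normal (h : IsAdapted 𝓕 g) (v : TangentSpace (𝓡 (n + 1)) p) :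
    g.inner p (hat 𝓕 g p v) (𝓕.normal p) = 0 := by
  rw [hat_apply, map_sub, map_smul, sub_apply, smul_apply, (h p).1, smul_eq_mul, mul_one, sub_self]

theorem IsAdapted.hat_mem (h : IsAdapted 𝓕 g) (v : TangentSpace (𝓡 (n + 1)) p) :
    hat 𝓕 g p v ∈ 𝓕.tangent p :=
  h.mem_tangent_iff.2 (h.inner_hat_normal v)

theorem IsAdapted.hat_of_mem (h : IsAdapted 𝓕 g) {v : TangentSpace (𝓡 (n + 1)) p}
    (hv : v ∈ 𝓕.tangent p) : hat 𝓕 g p v = v := by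
  rw [hat_apply, (h p).2 v hv, zero_smul, sub_zero]

theorem IsAdapted.hat_normal (h : IsAdapted 𝓕 g) : hat 𝓕 g p (𝓕.normal p) = 0 := by
  rw [hat_apply, (h p).1, one_smul, sub_self]

theorem IsAdapted.hat_eq (h : IsAdapted 𝓕 g) (h' : IsAdapted 𝓕 g') : hat 𝓕 g p = hat 𝓕 g' p := by
  ext1 v
  rw [hat_apply, hat_apply, h.inner_normal_eq h']

/-- This reduces the calculus of ĝ to that of g evaluated on smooth fields, N being one of them. -/
theorem IsAdapted.truncated_apply (h : IsAdapted 𝓕 g) (v w : TangentSpace (𝓡 (n + 1)) p) :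
    truncated 𝓕 g p v w =
      g.inner p v w - g.inner p v (𝓕.normal p) * g.inner p w (𝓕.normal p) := by
  have h1 : g.inner p (hat 𝓕 g p v) (hat 𝓕 g p w) = g.inner p (hat 𝓕 g p v) w := by
    rw [hat_apply w, map_sub, map_smul, h.inner_hat_normal, smul_zero, sub_zero]
  rw [truncated, h1, hat_apply, map_sub, map_smul, sub_apply, smul_apply, smul_eq_mul,
    g.symm p (𝓕.normal p) w]

theorem smoothField_hat {Y : VectorField n M} (hY : SmoothField Y) :
    SmoothField (fun q => hat 𝓕 g q (Y q)) := by
  simp only [hat_apply]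
  intro q
  exact ContMDiffAt.sub_section (hY q) ((contMDiffAt_inner g (hY q)
    (𝓕.smooth_normal q)).smul_section (𝓕.smooth_normal q))

theorem IsAdapted.exists_smoothField_mem [T2Space M] (h : IsAdapted 𝓕 g)
    {v : TangentSpace (𝓡 (n + 1)) p} (hv : v ∈ 𝓕.tangent p) :
    ∃ Y : VectorField n M, SmoothField Y ∧ (∀ q, Y q ∈ 𝓕.tangent q) ∧ Y p = v := by
  obtain ⟨Y, hY, hYp⟩ := exists_smoothField p v
  refine ⟨_, smoothField_hat (𝓕 := 𝓕) (g := g) hY, fun q => h.hat_mem _, ?_⟩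
  simp only [hYp]
  exact h.hat_of_mem hv

end Foliation

/-! ### Part (a): from self-similar solutions to the soliton equation -/

section Soliton

open Filter Topology VectorField

variable {n : ℕ} {M : Type*} [TopologicalSpace M]
  [ChartedSpace (EuclideanSpace ℝ (Fin (n + 1))) M] [IsManifold (𝓡 (n + 1)) ∞ M]
  {𝓕 : OrientedFoliation n M} {g : Metric n M} {p : M}
  {J : Set ℝ} {φ : ℝ → M → M} {X : VectorField n M}

/-- Because dψ(N) = N, the correction term of ψ^*ĝ is also a product of values of ψ^*g, so
derivatives of ψ^*g alone suffice. -/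
theorem truncated_eq_inner_mfderiv (hg : IsAdapted 𝓕 g) {ψ : M → M}
    (hN : mfderiv (𝓡 (n + 1)) (𝓡 (n + 1)) ψ p (𝓕.normal p) = 𝓕.normal (ψ p))
    (v w : TangentSpace (𝓡 (n + 1)) p) :
    truncated 𝓕 g (ψ p) (mfderiv (𝓡 (n + 1)) (𝓡 (n + 1)) ψ p v)
        (mfderiv (𝓡 (n + 1)) (𝓡 (n + 1)) ψ p w) =
      g.inner (ψ p) (mfderiv (𝓡 (n + 1)) (𝓡 (n + 1)) ψ p v)
        (mfderiv (𝓡 (n + 1)) (𝓡 (n + 1)) ψ p w) -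
      g.inner (ψ p) (mfderiv (𝓡 (n + 1)) (𝓡 (n + 1)) ψ p v)
        (mfderiv (𝓡 (n + 1)) (𝓡 (n + 1)) ψ p (𝓕.normal p)) *
      g.inner (ψ p) (mfderiv (𝓡 (n + 1)) (𝓡 (n + 1)) ψ p w)
        (mfderiv (𝓡 (n + 1)) (𝓡 (n + 1)) ψ p (𝓕.normal p)) := by
  rw [hg.truncated_apply, hN]

theorem mvfderiv_truncated (hg : IsAdapted 𝓕 g) {Y Z : VectorField n M} (hY : MDiffField Y p)
    (hZ : MDiffField Z p) (v : TangentSpace (𝓡 (n + 1)) p) :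
    mvfderiv (𝓡 (n + 1)) (fun q => truncated 𝓕 g q (Y q) (Z q)) p v =
      mvfderiv (𝓡 (n + 1)) (fun q => g.inner q (Y q) (Z q)) p v -
        (mvfderiv (𝓡 (n + 1)) (fun q => g.inner q (Y q) (𝓕.normal q)) p v *
            g.inner p (Z p) (𝓕.normal p) +
          g.inner p (Y p) (𝓕.normal p) *
            mvfderiv (𝓡 (n + 1)) (fun q => g.inner q (Z q) (𝓕.normal q)) p v) := by
  have hN := 𝓕.smooth_normal.mDiffField p
  have h1 := (mdifferentiableAt_inner g hY hZ).hasMFDerivAt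
  have h2 := (mdifferentiableAt_inner g hY hN).hasMFDerivAt
  have h3 := (mdifferentiableAt_inner g hZ hN).hasMFDerivAt
  have h4 : HasMFDerivAt (𝓡 (n + 1)) 𝓘(ℝ, ℝ) (fun q => truncated 𝓕 g q (Y q) (Z q)) p _ :=
    (h1.sub (h2.mul h3)).congr_of_eventuallyEq
      (Eventually.of_forall fun q => hg.truncated_apply (Y q) (Z q))
  have h5 := congrArg (fun L : EuclideanSpace ℝ (Fin (n + 1)) →L[ℝ] ℝ => L v) h4.mfderiv
  have key : ∀ (A B C : EuclideanSpace ℝ (Fin (n + 1)) →L[ℝ] ℝ) (b c : ℝ)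
      (v : EuclideanSpace ℝ (Fin (n + 1))),
      (A - (b • C + c • B)) v = A v - (B v * c + b * C v) := by
    intro A B C b c v
    simp only [sub_apply, add_apply, smul_apply, smul_eq_mul]
    ring
  exact h5.trans (key _ _ _ _ _ v)

/-- Apply the product rule to g − g(·,N)g(·,N); [X,N] = 0 removes the brackets that fall on N. -/
theorem IsVariation.hasDerivWithinAt_truncated (h : IsVariation (𝓡 (n + 1)) J φ X)
    (hg : IsAdapted 𝓕 g)
    (hφN : ∀ s ∈ J, mfderiv (𝓡 (n + 1)) (𝓡 (n + 1)) (φ s) p (𝓕.normal p) = 𝓕.normal (φ s p))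
    (hXN : mlieBracket (𝓡 (n + 1)) X 𝓕.normal p = 0) (hX : MDiffField X p)
    {Y Z : VectorField n M} (hY : MDiffField Y p) (hZ : MDiffField Z p) :
    HasDerivWithinAt (fun s => truncated 𝓕 g (φ s p)
        (mfderiv (𝓡 (n + 1)) (𝓡 (n + 1)) (φ s) p (Y p))
        (mfderiv (𝓡 (n + 1)) (𝓡 (n + 1)) (φ s) p (Z p)))
      (lieDerivative X (truncated 𝓕 g) Y Z p) J 0 := by
  have hN := 𝓕.smooth_normal.mDiffField p
  have h1 := h.hasDerivWithinAt_pullback (g.contMDiff p) hX hY hZ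
  have h2 := h.hasDerivWithinAt_pullback (g.contMDiff p) hX hY hN
  have h3 := h.hasDerivWithinAt_pullback (g.contMDiff p) hX hZ hN
  rw [hXN, map_zero, sub_zero] at h2 h3
  refine ((h1.sub (h2.mul h3)).congr_of_mem (fun s hs =>
    truncated_eq_inner_mfderiv hg (hφN s hs) (Y p) (Z p)) h.zero_mem).congr_deriv ?_
  have h0 : ∀ v : TangentSpace (𝓡 (n + 1)) p,
      g.inner (φ 0 p) (mfderiv (𝓡 (n + 1)) (𝓡 (n + 1)) (φ 0) p v)
        (mfderiv (𝓡 (n + 1)) (𝓡 (n + 1)) (φ 0) p (𝓕.normal p)) =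
      g.inner p v (𝓕.normal p) := by
    intro v
    have : φ 0 = id := funext h.init
    rw [this, mfderiv_id]
    rfl
  rw [h0, h0, lieDerivative, mvfderiv_truncated hg hY hZ, hg.truncated_apply, hg.truncated_apply]
  ring

/-- If the maps `φ s` preserve `N`, their velocity commutes with `N`. -/
theorem IsVariation.mlieBracket_eq_zero (h : IsVariation (𝓡 (n + 1)) J φ X)
    (hX : MDiffField X p) {N : VectorField n M} (hN : MDiffField N p)
    (hφN : ∀ s ∈ J, mfderiv (𝓡 (n + 1)) (𝓡 (n + 1)) (φ s) p (N p) = N (φ s p)) :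
    mlieBracket (𝓡 (n + 1)) X N p = 0 := by
  have hu : ContMDiffAt (𝓡 (n + 1)) 𝓘(ℝ, EuclideanSpace ℝ (Fin (n + 1))) ∞
    (extChartAt (𝓡 (n + 1)) p) p := contMDiffAt_extChartAt
  have h1 := h.hasDerivWithinAt_mfderiv_sub hu hX hN
  have h2 := h.hasDerivWithinAt (mdifferentiableAt_mvfderiv_apply (hu.of_le two_le_infty) hN)
  -- One and the same curve has the derivatives X(Nu) − [X,N]u and X(Nu), with u the chart at p.
  have h3 := h.uniqueDiffWithinAt.eq_deriv _ (h1.congr_of_mem (fun s hs => by rw [hφN s hs])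
    h.zero_mem) h2
  rw [sub_eq_self] at h3
  exact (congrArg (fun L : EuclideanSpace ℝ (Fin (n + 1)) →L[ℝ] EuclideanSpace ℝ (Fin (n + 1)) =>
    L (mlieBracket (𝓡 (n + 1)) X N p)) (mfderiv_extChartAt_self (I := 𝓡 (n + 1))
      (x := p))).symm.trans h3

/-- If the maps `φ s` preserve `N` and `T𝓕`, so does their velocity. -/
theorem IsVariation.mlieBracket_mem (h : IsVariation (𝓡 (n + 1)) J φ X)
    (hg : IsAdapted 𝓕 g)
    (hφN : ∀ s ∈ J, mfderiv (𝓡 (n + 1)) (𝓡 (n + 1)) (φ s) p (𝓕.normal p) = 𝓕.normal (φ s p))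
    (hφT : ∀ s ∈ J, ∀ v ∈ 𝓕.tangent p,
      mfderiv (𝓡 (n + 1)) (𝓡 (n + 1)) (φ s) p v ∈ 𝓕.tangent (φ s p))
    (hX : MDiffField X p) {Y : VectorField n M} (hY : MDiffField Y p)
    (hYT : ∀ q, Y q ∈ 𝓕.tangent q) :
    mlieBracket (𝓡 (n + 1)) X Y p ∈ 𝓕.tangent p := by
  have hN := 𝓕.smooth_normal.mDiffField p
  have h1 := h.hasDerivWithinAt_pullback (g.contMDiff p) hX hY hN
  rw [h.mlieBracket_eq_zero hX hN hφN, map_zero, sub_zero] at h1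
  -- Both the function g(Y,N) and the curve g(dφ_s Y, dφ_s N) vanish identically, so the derivative
  -- formula leaves g([X,Y],N) = 0.
  have h2 : (fun q => g.inner q (Y q) (𝓕.normal q)) = fun _ => 0 :=
    funext fun q => (hg q).2 _ (hYT q)
  have h3 := h.uniqueDiffWithinAt.eq_deriv _ (h1.congr_of_mem (f₁ := fun _ => 0) (fun s hs => by
    rw [hφN s hs]; exact ((hg _).2 _ (hφT s hs _ (hYT p))).symm) h.zero_mem)
    (hasDerivWithinAt_const _ _ _)
  rw [h2, mvfderiv_const] at h3
  refine hg.mem_tangent_iff.2 ?_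
  simpa using h3

/-- A smooth family of maps `φ s` with `φ 0 = id` has a smooth velocity field at `s = 0`. -/
theorem exists_isVariation (hJ : Convex ℝ J) (hJ' : (interior J).Nonempty) (h0 : (0 : ℝ) ∈ J)
    (hφ : ContMDiffOn (𝓘(ℝ, ℝ).prod (𝓡 (n + 1))) (𝓡 (n + 1)) ∞ (fun z : ℝ × M => φ z.1 z.2)
      (J ×ˢ univ)) (hφ0 : ∀ q, φ 0 q = q) :
    ∃ X : VectorField n M, SmoothField X ∧ IsVariation (𝓡 (n + 1)) J φ X := by
  -- The velocity naturally lives over φ 0 q, which equals q only by hypothesis; V and X are the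
  -- same E-valued function over these two base points.
  let V : (q : M) → TangentSpace (𝓡 (n + 1)) (φ 0 q) := fun q =>
    mfderivWithin 𝓘(ℝ, ℝ) (𝓡 (n + 1)) (fun s => φ s q) J 0 (1 : ℝ)
  let X : VectorField n M := fun q => V q
  have hu : UniqueMDiffOn 𝓘(ℝ, ℝ) J :=
    (uniqueDiffOn_convex hJ hJ').uniqueMDiffOn
  have hVX : (fun q => (⟨φ 0 q, V q⟩ : TangentBundle (𝓡 (n + 1)) M)) = fun q => ⟨q, X q⟩ := by
    funext q
    have : ∀ (q' : M) (v : EuclideanSpace ℝ (Fin (n + 1))), q' = q →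
        (⟨q', v⟩ : TangentBundle (𝓡 (n + 1)) M) = ⟨q, v⟩ := by
      rintro _ v rfl
      rfl
    exact this _ _ (hφ0 q)
  refine ⟨X, fun p => ?_, hJ, hJ', h0, hφ, hφ0, fun q => ?_⟩
  · rw [← hVX]
    have hswap : ContMDiffWithinAt ((𝓡 (n + 1)).prod 𝓘(ℝ, ℝ)) (𝓡 (n + 1)) ∞
        (Function.uncurry fun (q : M) (s : ℝ) => φ s q) (univ ×ˢ J) (p, 0) :=
      ContMDiffWithinAt.comp (t := J ×ˢ univ) (f := Prod.swap) (g := fun z : ℝ × M => φ z.1 z.2)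
        (p, (0 : ℝ)) (hφ (0, p) ⟨h0, mem_univ p⟩)
        (contMDiff_snd.prodMk contMDiff_fst).contMDiffAt.contMDiffWithinAt
        (fun z hz => ⟨hz.2, mem_univ _⟩)
    have h1 := ContMDiffWithinAt.mfderivWithin (m := ∞) (g := fun _ : M => (0 : ℝ)) hswap
      contMDiffWithinAt_const (mem_univ p) (fun _ _ => h0) (by simp) hu
    have hv : ContMDiffAt (𝓡 (n + 1)) 𝓘(ℝ, ℝ).tangent ∞
        (fun _ : M => (⟨0, (1 : ℝ)⟩ : TangentBundle 𝓘(ℝ, ℝ) ℝ)) p := contMDiffAt_const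
    have h2 := ContMDiffAt.clm_apply_of_inCoordinates (contMDiffWithinAt_univ.1 h1) hv
      (contMDiffAt_id.congr_of_eventuallyEq (.of_forall hφ0))
    exact h2
  · have h1 : MDifferentiableWithinAt 𝓘(ℝ, ℝ) (𝓡 (n + 1)) (fun s => φ s q) J 0 :=
      (ContMDiffWithinAt.comp (t := J ×ˢ univ) (f := fun s : ℝ => (s, q))
        (g := fun z : ℝ × M => φ z.1 z.2) 0 (hφ (0, q) ⟨h0, mem_univ q⟩)
        (contMDiff_id.prodMk contMDiff_const).contMDiffAt.contMDiffWithinAt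
        (fun s hs => ⟨hs, mem_univ _⟩)).mdifferentiableWithinAt (by simp)
    have h2 : mfderivWithin 𝓘(ℝ, ℝ) (𝓡 (n + 1)) (fun s => φ s q) J 0 =
        (1 : ℝ →L[ℝ] ℝ).smulRight (X (φ 0 q)) := by
      have hX : V q = X (φ 0 q) :=
        congrArg (fun q => (X q : EuclideanSpace ℝ (Fin (n + 1)))) (hφ0 q).symm
      rw [← hX]
      refine ContinuousLinearMap.ext_ring ?_
      exact (one_smul ℝ (V q)).symm
    rw [← h2]
    exact h1.hasMFDerivWithinAt

/-- X is the velocity of φ_t at 0 and ε = σ'(0); the equation is the uniqueness of the (possibly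
one-sided) derivative of g_t at 0. -/
theorem exists_solitonEquation {f : Fin n → (Fin n → ℝ) → ℝ} {g : ℝ → Metric n M}
    (hJ : J.OrdConnected) (hJ' : J.Nontrivial) (h0 : (0 : ℝ) ∈ J)
    (h : IsSelfSimilarEGS f 𝓕 J g) :
    ∃ (X : VectorField n M) (ε : ℝ), FieldPreservesFN 𝓕 X ∧ SolitonEquation f 𝓕 (g 0) X ε := by
  obtain ⟨σ, φ, h⟩ := h
  have hint : (interior J).Nonempty := by
    obtain ⟨a, ha, b, hb, hab⟩ := hJ'.exists_lt
    exact ⟨(a + b) / 2, interior_mono (hJ.out ha hb) (by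
      rw [interior_Icc]; constructor <;> linarith)⟩
  obtain ⟨X, hXs, hX⟩ := exists_isVariation (φ := fun t => φ t) hJ.convex hint h0 h.smooth h.init
  have hg0 := h.isEGF.adapted 0 h0
  have hφN : ∀ p, ∀ s ∈ J,
      mfderiv (𝓡 (n + 1)) (𝓡 (n + 1)) (φ s) p (𝓕.normal p) = 𝓕.normal (φ s p) :=
    fun p s hs => (h.preserves s hs p).2
  have hφT : ∀ p, ∀ s ∈ J, ∀ v ∈ 𝓕.tangent p,
      mfderiv (𝓡 (n + 1)) (𝓡 (n + 1)) (φ s) p v ∈ 𝓕.tangent (φ s p) := fun p s hs v hv =>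
    (h.preserves s hs p).1 ▸ Submodule.mem_map_of_mem hv
  have hXN : ∀ p, mlieBracket (𝓡 (n + 1)) X 𝓕.normal p = 0 := fun p =>
    hX.mlieBracket_eq_zero (hXs.mDiffField p) (𝓕.smooth_normal.mDiffField p) (hφN p)
  refine ⟨X, derivWithin σ J 0, ⟨hXs, fun Y hY hYT p => hX.mlieBracket_mem hg0 (hφN p) (hφT p)
    (hXs.mDiffField p) (hY.mDiffField p) hYT, hXN⟩, ?_⟩
  obtain ⟨nabla, hLC, hflow⟩ := h.isEGF.flow 0 h0
  refine ⟨nabla, hLC, fun Y Z hY hZ p => ?_⟩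
  have h1 := hflow p (Y p) (Z p)
  have h2 := hX.hasDerivWithinAt_truncated hg0 (hφN p) (hXN p) (hXs.mDiffField p)
    (hY.mDiffField p) (hZ.mDiffField p)
  have hσ : HasDerivWithinAt σ (derivWithin σ J 0) J 0 :=
    ((h.scale_smooth 0 h0).differentiableWithinAt (by simp)).hasDerivWithinAt
  -- The added constant is the time-independent part g_t(Y,N) g_t(Z,N).
  have h3 := (hσ.mul h2).add_const
    ((g 0).inner p (Y p) (𝓕.normal p) * (g 0).inner p (Z p) (𝓕.normal p))
  have h4 := hX.uniqueDiffWithinAt.eq_deriv _ h1 (h3.congr_of_mem (fun s hs => by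
    have hs' := h.isEGF.adapted s hs
    have e1 := h.selfSimilar s hs p (Y p) (Z p)
    rw [hs'.truncated_apply, hs'.inner_normal_eq hg0, hs'.inner_normal_eq hg0] at e1
    exact sub_eq_iff_eq_add.1 e1) h0)
  -- At t = 0 self-similarity reads ĝ_0 = φ_0^*ĝ_0, which identifies the coefficient of σ'(0).
  have h5 := h.selfSimilar 0 h0 p (Y p) (Z p)
  rw [h.scale_zero, one_mul] at h5 h4
  rw [h4, h5]
  rfl

end Soliton

/-! ### The flow of a field in 𝒳(𝓕, N) preserves 𝓕 and N -/

section Flow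

open Filter Topology VectorField

variable {n : ℕ} {M : Type*} [TopologicalSpace M]
  [ChartedSpace (EuclideanSpace ℝ (Fin (n + 1))) M] [IsManifold (𝓡 (n + 1)) ∞ M]
  {𝓕 : OrientedFoliation n M} {g : Metric n M} {X : VectorField n M} {ψ : ℝ → Diffeo n M}

namespace IsFlowOf

theorem isVariation (h : IsFlowOf X ψ) : IsVariation (𝓡 (n + 1)) univ (fun t => ψ t) X where
  convex := convex_univ
  interior_nonempty := by rw [interior_univ]; exact univ_nonempty
  zero_mem := mem_univ _
  smooth := h.smooth
  init := h.zero
  velocity q := (h.integralCurve q 0).hasMFDerivWithinAt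

/-- The differential of the flow, as an endomorphism of the model space. -/
def deriv (_ : IsFlowOf X ψ) (t : ℝ) (p : M) :
    EuclideanSpace ℝ (Fin (n + 1)) →L[ℝ] EuclideanSpace ℝ (Fin (n + 1)) :=
  mfderiv (𝓡 (n + 1)) (𝓡 (n + 1)) (ψ t) p

theorem deriv_zero (h : IsFlowOf X ψ) (p : M) : h.deriv 0 p = .id ℝ _ := by
  have : (ψ 0 : M → M) = id := funext h.zero
  rw [deriv, this]
  exact mfderiv_id

theorem deriv_add (h : IsFlowOf X ψ) (s t : ℝ) (p : M) :
    h.deriv (s + t) p = (h.deriv s (ψ t p)).comp (h.deriv t p) := by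
  have : (ψ (s + t) : M → M) = ψ s ∘ ψ t := funext (h.add s t)
  rw [deriv, this]
  exact mfderiv_comp p ((ψ s).contMDiff.mdifferentiableAt (by simp))
    ((ψ t).contMDiff.mdifferentiableAt (by simp))

theorem neg_apply_self (h : IsFlowOf X ψ) (t : ℝ) (p : M) : ψ (-t) (ψ t p) = p := by
  rw [← h.add, neg_add_cancel, h.zero]

theorem deriv_deriv_neg (h : IsFlowOf X ψ) (t : ℝ) (p : M) (v : EuclideanSpace ℝ (Fin (n + 1))) :
    h.deriv t p (h.deriv (-t) (ψ t p) v) = v := by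
  have := h.deriv_add t (-t) (ψ t p)
  rw [add_neg_cancel, h.deriv_zero, h.neg_apply_self] at this
  exact (congrArg (fun L => L v) this).symm

/-- The hypothesis is phrased by shifted curves because the group law turns a derivative at time t
into one at time 0. -/
theorem eq_of_hasDerivAt {F : Type*} [NormedAddCommGroup F] [NormedSpace ℝ F] {c : ℝ → F}
    (hc : ∀ t, HasDerivAt (fun s => c (s + t)) 0 0) (t : ℝ) : c t = c 0 := by
  have hd : ∀ t, HasDerivAt c 0 t := fun t => by
    have h1 : HasDerivAt (fun s => c (s + t)) 0 (t - t) := by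
      rw [sub_self]; exact hc t
    simpa using h1.comp_sub_const t t
  exact is_const_of_deriv_eq_zero (fun t => (hd t).differentiableAt) (fun t => (hd t).deriv) t 0

/-- The flow of a field that commutes with `N` preserves `N`. -/
theorem deriv_normal (h : IsFlowOf X ψ) (hX : SmoothField X) {N : VectorField n M}
    (hN : SmoothField N) (hXN : ∀ p, mlieBracket (𝓡 (n + 1)) X N p = 0) (t : ℝ) (p : M) :
    h.deriv t p (N p) = N (ψ t p) := by
  -- This is (ψ_{-t})_*N at p. The shifted curve c(s + t) is dψ_{-t} applied to the same curve based
  -- at ψ_t p, which is stationary at s = 0.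
  let c : ℝ → EuclideanSpace ℝ (Fin (n + 1)) := fun t => h.deriv (-t) (ψ t p) (N (ψ t p))
  have hc : ∀ t, c t = c 0 := by
    refine eq_of_hasDerivAt fun t => ?_
    let w : ℝ → EuclideanSpace ℝ (Fin (n + 1)) := fun s =>
      h.deriv (-s) (ψ s (ψ t p)) (N (ψ s (ψ t p)))
    have hw : HasDerivAt w 0 0 := hasDerivWithinAt_univ.1 <|
      h.isVariation.hasDerivWithinAt_zero_of_mlieBracket_eq_zero (hX.mDiffField (ψ t p))
        (hN.mDiffField (ψ t p)) (hXN (ψ t p))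
        (.of_forall fun s => h.deriv_deriv_neg s (ψ t p) (N (ψ s (ψ t p))))
    have h1 := (h.deriv (-t) (ψ t p)).hasFDerivAt.comp_hasDerivAt 0 hw
    rw [map_zero] at h1
    refine h1.congr_of_eventuallyEq (.of_forall fun s => ?_)
    change h.deriv (-(s + t)) (ψ (s + t) p) (N (ψ (s + t) p)) = h.deriv (-t) (ψ t p) (w s)
    rw [h.add, neg_add_rev, h.deriv_add, h.neg_apply_self]
    rfl
  have h0 : c 0 = N p := by
    change h.deriv (-0) (ψ 0 p) (N (ψ 0 p)) = N p
    rw [neg_zero, h.zero, h.deriv_zero]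
    rfl
  rw [← h0, ← hc t]
  exact h.deriv_deriv_neg t p _

/-- T𝓕 is the kernel of g(·,N), so this is invariance of T𝓕. At time t split dψ_t v = Y + bN and
extend Y to a field in T𝓕: the Y-part has derivative −g([X,Y],N) = 0, and the N-part contributes the
constant b because the flow preserves N. -/
theorem inner_deriv_normal [T2Space M] (h : IsFlowOf X ψ) (hX : FieldPreservesFN 𝓕 X)
    (hg : IsAdapted 𝓕 g) (t : ℝ) (p : M) (v : EuclideanSpace ℝ (Fin (n + 1))) :
    g.inner (ψ t p) (h.deriv t p v) (𝓕.normal (ψ t p)) = g.inner p v (𝓕.normal p) := by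
  obtain ⟨hXs, hXT, hXN⟩ := hX
  let c : ℝ → ℝ := fun t => g.inner (ψ t p) (h.deriv t p v) (𝓕.normal (ψ t p))
  have hc : ∀ t, c t = c 0 := by
    refine eq_of_hasDerivAt fun t => ?_
    obtain ⟨b, hb⟩ := exists_sub_smul_normal_mem 𝓕 (ψ t p) (h.deriv t p v)
    obtain ⟨Y, hY, hYT, hYp⟩ := hg.exists_smoothField_mem hb
    have h1 := h.isVariation.hasDerivWithinAt_pullback (g.contMDiff (ψ t p))
      (hXs.mDiffField _) (hY.mDiffField _) (𝓕.smooth_normal.mDiffField _)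
    have h2 : (fun q => g.inner q (Y q) (𝓕.normal q)) = fun _ => 0 :=
      funext fun q => (hg q).2 _ (hYT q)
    rw [hXN, map_zero, sub_zero, (hg _).2 _ (hXT Y hY hYT _), sub_zero, h2, mvfderiv_const,
      hasDerivWithinAt_univ] at h1
    refine (h1.add_const b).congr_of_eventuallyEq (.of_forall fun s => ?_)
    change g.inner (ψ (s + t) p) (h.deriv (s + t) p v) (𝓕.normal (ψ (s + t) p)) =
      g.inner (ψ s (ψ t p)) (h.deriv s (ψ t p) (Y (ψ t p)))
        (h.deriv s (ψ t p) (𝓕.normal (ψ t p))) + b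
    let a : EuclideanSpace ℝ (Fin (n + 1)) := h.deriv s (ψ t p) (Y (ψ t p))
    let N' : EuclideanSpace ℝ (Fin (n + 1)) := 𝓕.normal (ψ s (ψ t p))
    have e1 : h.deriv (s + t) p v = a + b • N' := by
      have e2 := h.deriv_normal hXs 𝓕.smooth_normal hXN s (ψ t p)
      have e3 : h.deriv t p v = Y (ψ t p) + b • 𝓕.normal (ψ t p) := by
        rw [hYp]; exact (sub_add_cancel _ _).symm
      rw [h.deriv_add, ContinuousLinearMap.comp_apply, e3]
      refine (map_add _ _ _).trans (congrArg₂ _ rfl ?_)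
      exact (map_smul _ _ _).trans (congrArg (b • ·) e2)
    rw [h.deriv_normal hXs 𝓕.smooth_normal hXN s (ψ t p), e1, h.add]
    have e4 : ∀ (q : M) (a : TangentSpace (𝓡 (n + 1)) q),
        g.inner q (a + b • 𝓕.normal q) (𝓕.normal q) = g.inner q a (𝓕.normal q) + b := by
      intro q a
      rw [map_add, map_smul, add_apply, smul_apply, (hg q).1, smul_eq_mul, mul_one]
    exact e4 _ _
  have h0 : c 0 = g.inner p v (𝓕.normal p) := by
    change g.inner (ψ 0 p) (h.deriv 0 p v) (𝓕.normal (ψ 0 p)) = _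
    rw [h.deriv_zero, h.zero]
    rfl
  rw [← h0, ← hc t]

/-- The flow of a field in `𝒳(𝓕, N)` belongs to `𝒟(𝓕, N)`. -/
theorem preservesFN [T2Space M] (h : IsFlowOf X ψ) (hX : FieldPreservesFN 𝓕 X)
    (hg : IsAdapted 𝓕 g) (t : ℝ) : PreservesFN 𝓕 (ψ t) := by
  refine fun p => ⟨?_, h.deriv_normal hX.1 𝓕.smooth_normal hX.2.2 t p⟩
  ext w
  rw [Submodule.mem_map]
  constructor
  · rintro ⟨v, hv, rfl⟩
    exact hg.mem_tangent_iff.2 ((h.inner_deriv_normal hX hg t p v).trans (hg.mem_tangent_iff.1 hv))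
  · intro hw
    refine ⟨h.deriv (-t) (ψ t p) w, hg.mem_tangent_iff.2 ?_, h.deriv_deriv_neg t p w⟩
    have h1 := h.inner_deriv_normal hX hg t p (h.deriv (-t) (ψ t p) w)
    have h2 := congrArg (fun a : EuclideanSpace ℝ (Fin (n + 1)) =>
      g.inner (ψ t p) a (𝓕.normal (ψ t p))) (h.deriv_deriv_neg t p w)
    exact (h1.symm.trans h2).trans (hg.mem_tangent_iff.1 hw)

end IsFlowOf

end Flow

/-! ### Positive forms and smooth dependence on parameters -/

section PullbackSmooth

open Filter Topology VectorField

variable {E : Type*} [NormedAddCommGroup E] [NormedSpace ℝ E]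

/-- With m > 0 the minimum of B(v,v) on the compact unit sphere, B(v,v) ≥ m‖v‖². -/
theorem isVonNBounded_of_pos [FiniteDimensional ℝ E] (B : E →L[ℝ] E →L[ℝ] ℝ)
    (hB : ∀ v, v ≠ 0 → 0 < B v v) : Bornology.IsVonNBounded ℝ {v : E | B v v < 1} := by
  have : ProperSpace E := FiniteDimensional.proper ℝ E
  rcases subsingleton_or_nontrivial E with hE | hE
  · exact (Set.subsingleton_of_subsingleton.finite).isVonNBounded
  obtain ⟨u, hu, hmin⟩ := (isCompact_sphere (0 : E) 1).exists_isMinOn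
    (NormedSpace.sphere_nonempty.2 zero_le_one) (f := fun v => B v v)
    (B.continuous.clm_apply continuous_id).continuousOn
  have hu0 : u ≠ 0 := by
    rintro rfl
    simp at hu
  have hm := hB u hu0
  have hle : ∀ v, B u u * ‖v‖ ^ 2 ≤ B v v := by
    intro v
    rcases eq_or_ne v 0 with rfl | hv
    · simp
    have hv' : 0 < ‖v‖ := norm_pos_iff.2 hv
    have h1 : B u u ≤ B (‖v‖⁻¹ • v) (‖v‖⁻¹ • v) := hmin (by
      simp [norm_smul, hv'.ne'])
    rw [map_smul, map_smul, smul_apply, smul_eq_mul, smul_eq_mul] at h1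
    calc B u u * ‖v‖ ^ 2 ≤ ‖v‖⁻¹ * (‖v‖⁻¹ * B v v) * ‖v‖ ^ 2 := by gcongr
      _ = B v v := by field_simp
  rw [NormedSpace.isVonNBounded_iff]
  -- The bound ‖v‖ ≤ 1 + ‖v‖² avoids a square root.
  refine (Metric.isBounded_iff_subset_closedBall 0).2 ⟨1 + (B u u)⁻¹, fun v hv => ?_⟩
  rw [mem_closedBall_zero_iff]
  have h1 : ‖v‖ ^ 2 ≤ (B u u)⁻¹ := by
    rw [← one_div, le_div_iff₀ hm, mul_comm]
    exact (hle v).trans (le_of_lt hv)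
  nlinarith [norm_nonneg v, inv_pos.2 hm]

variable {H : Type*} [TopologicalSpace H] {I : ModelWithCorners ℝ E H}
  {M : Type*} [TopologicalSpace M] [ChartedSpace H M] [IsManifold I ∞ M]
  {E' : Type*} [NormedAddCommGroup E'] [NormedSpace ℝ E']
  {H' : Type*} [TopologicalSpace H'] {I' : ModelWithCorners ℝ E' H'}
  {P : Type*} [TopologicalSpace P] [ChartedSpace H' P]

/-- The parameter space P serves both a single diffeomorphism (P = M) and a flow (P = ℝ × M). -/
theorem contMDiffAt_mfderiv_apply [IsManifold I' ∞ P] {Φ : P → M → M} {b : P → M} {m : P}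
    (hΦ : ContMDiffAt (I'.prod I) I ∞ (Function.uncurry Φ) (m, b m))
    (hb : ContMDiffAt I' I ∞ b m) {Y : (q : M) → TangentSpace I q}
    (hY : ContMDiffAt I I.tangent ∞ (fun q => (⟨q, Y q⟩ : TangentBundle I M)) (b m)) :
    ContMDiffAt I' I.tangent ∞ (fun m => (⟨Φ m (b m), mfderiv I I (Φ m) (b m) (Y (b m))⟩ :
      TangentBundle I M)) m := by
  have h1 := ContMDiffAt.mfderiv (m := ∞) (n := ∞) Φ b hΦ hb (by simp)
  have hY' : ContMDiffAt I' I.tangent ∞ (fun m => (⟨b m, Y (b m)⟩ : TangentBundle I M)) m :=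
    hY.comp m hb
  have hb' : ContMDiffAt I' I ∞ (fun m => Φ m (b m)) m :=
    hΦ.comp m (contMDiffAt_id.prodMk hb)
  exact ContMDiffAt.clm_apply_of_inCoordinates h1 hY' hb'

theorem contMDiffAt_bilin_apply {b : P → M} {m : P}
    {T : (q : M) → TangentSpace I q →L[ℝ] TangentSpace I q →L[ℝ] ℝ}
    (hT : ContMDiffAt I (I.prod 𝓘(ℝ, E →L[ℝ] E →L[ℝ] ℝ)) ∞
      (fun q => TotalSpace.mk' (E →L[ℝ] E →L[ℝ] ℝ)
        (E := fun q : M => TangentSpace I q →L[ℝ] TangentSpace I q →L[ℝ] ℝ) q (T q)) (b m))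
    {Y Z : (m : P) → TangentSpace I (b m)}
    (hY : ContMDiffAt I' I.tangent ∞ (fun m => (⟨b m, Y m⟩ : TangentBundle I M)) m)
    (hZ : ContMDiffAt I' I.tangent ∞ (fun m => (⟨b m, Z m⟩ : TangentBundle I M)) m) :
    ContMDiffAt I' 𝓘(ℝ, ℝ) ∞ (fun m => T (b m) (Y m) (Z m)) m := by
  have hb : ContMDiffAt I' I ∞ b m := by
    rw [contMDiffAt_totalSpace] at hY
    exact hY.1
  have h : ContMDiffAt I' (I.prod 𝓘(ℝ, ℝ)) ∞ (fun m => TotalSpace.mk' ℝ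
      (E := Bundle.Trivial M ℝ) (b m) (T (b m) (Y m) (Z m))) m := by
    apply ContMDiffAt.clm_bundle_apply₂ (F₁ := E) (F₂ := E)
    · exact hT.comp m hb
    · exact hY
    · exact hZ
  rw [contMDiffAt_totalSpace] at h
  exact h.2

end PullbackSmooth

/-! ### Leafwise rescaling and pull-back of metrics -/

section Metrics

open Filter Topology VectorField

variable {n : ℕ} {M : Type*} [TopologicalSpace M]
  [ChartedSpace (EuclideanSpace ℝ (Fin (n + 1))) M] [IsManifold (𝓡 (n + 1)) ∞ M]
  {𝓕 : OrientedFoliation n M} {g : Metric n M}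

/-- A Riemannian metric, given by positive bilinear forms whose values on smooth fields are
smooth. -/
def metricOfBilin
    (B : (q : M) → TangentSpace (𝓡 (n + 1)) q →L[ℝ] TangentSpace (𝓡 (n + 1)) q →L[ℝ] ℝ)
    (symm : ∀ q v w, B q v w = B q w v) (pos : ∀ q v, v ≠ 0 → 0 < B q v v)
    (smooth : ∀ (p : M) (Y Z : VectorField n M),
      ContMDiffAt (𝓡 (n + 1)) (𝓡 (n + 1)).tangent ∞
        (fun q => (⟨q, Y q⟩ : TangentBundle (𝓡 (n + 1)) M)) p →
      ContMDiffAt (𝓡 (n + 1)) (𝓡 (n + 1)).tangent ∞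
        (fun q => (⟨q, Z q⟩ : TangentBundle (𝓡 (n + 1)) M)) p →
      ContMDiffAt (𝓡 (n + 1)) 𝓘(ℝ, ℝ) ∞ (fun q => B q (Y q) (Z q)) p) : Metric n M where
  inner := B
  symm := symm
  pos := pos
  isVonNBounded q := isVonNBounded_of_pos (E := EuclideanSpace ℝ (Fin (n + 1))) (B q) (pos q)
  contMDiff p := contMDiffAt_bilin_of_forall contMDiffAt_id (smooth p)

/-- The metric `c ĝ + g(·, N) g(·, N)`. -/
def IsAdapted.rescale (hg : IsAdapted 𝓕 g) {c : ℝ} (hc : 0 < c) : Metric n M :=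
  metricOfBilin
    -- Obtained by substituting ĝ = g − g(·,N)g(·,N); smoothness then involves only g and N.
    (fun q => c • g.inner q + (1 - c) • (g.inner q (𝓕.normal q)).smulRight
      (g.inner q (𝓕.normal q)))
    (fun q v w => by
      simp only [add_apply, smul_apply, ContinuousLinearMap.smulRight_apply, smul_eq_mul,
        g.symm q v w]
      ring)
    (fun q v hv => by
      have h1 : c * g.inner q v v + (1 - c) * (g.inner q v (𝓕.normal q) *
          g.inner q v (𝓕.normal q)) =
          c * g.inner q (hat 𝓕 g q v) (hat 𝓕 g q v) + g.inner q v (𝓕.normal q) ^ 2 := by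
        have := hg.truncated_apply v v
        rw [truncated] at this
        rw [this]
        ring
      simp only [add_apply, smul_apply, ContinuousLinearMap.smulRight_apply, smul_eq_mul,
        g.symm q (𝓕.normal q)]
      rw [h1]
      by_cases h2 : hat 𝓕 g q v = 0
      · have h3 : g.inner q v (𝓕.normal q) ≠ 0 := by
          intro h3
          rw [hat_apply, h3, zero_smul, sub_zero] at h2
          exact hv h2
        rw [h2, map_zero, mul_zero, zero_add]
        positivity
      · have := g.pos q _ h2
        positivity)
    (fun p Y Z hY hZ => by
      have hN := 𝓕.smooth_normal p
      have h := ((contMDiffAt_const (c := c)).mul (contMDiffAt_inner g hY hZ)).add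
        ((contMDiffAt_const (c := 1 - c)).mul
          ((contMDiffAt_inner g hN hY).mul (contMDiffAt_inner g hN hZ)))
      exact h)

theorem IsAdapted.rescale_inner (hg : IsAdapted 𝓕 g) {c : ℝ} (hc : 0 < c) (p : M)
    (v w : TangentSpace (𝓡 (n + 1)) p) :
    (hg.rescale hc).inner p v w = c * g.inner p v w +
      (1 - c) * (g.inner p v (𝓕.normal p) * g.inner p w (𝓕.normal p)) := by
  rw [g.symm p v (𝓕.normal p), g.symm p w (𝓕.normal p)]
  rfl

theorem IsAdapted.rescale_inner_normal (hg : IsAdapted 𝓕 g) {c : ℝ} (hc : 0 < c) (p : M)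
    (v : TangentSpace (𝓡 (n + 1)) p) :
    (hg.rescale hc).inner p v (𝓕.normal p) = g.inner p v (𝓕.normal p) := by
  rw [hg.rescale_inner, (hg p).1]
  ring

theorem IsAdapted.isAdapted_rescale (hg : IsAdapted 𝓕 g) {c : ℝ} (hc : 0 < c) :
    IsAdapted 𝓕 (hg.rescale hc) := fun p =>
  ⟨by rw [hg.rescale_inner_normal, (hg p).1], fun v hv => by
    rw [hg.rescale_inner_normal, (hg p).2 v hv]⟩

theorem IsAdapted.truncated_rescale (hg : IsAdapted 𝓕 g) {c : ℝ} (hc : 0 < c) (p : M)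
    (v w : TangentSpace (𝓡 (n + 1)) p) :
    truncated 𝓕 (hg.rescale hc) p v w = c * truncated 𝓕 g p v w := by
  rw [(hg.isAdapted_rescale hc).truncated_apply, hg.truncated_apply, hg.rescale_inner_normal,
    hg.rescale_inner_normal, hg.rescale_inner]
  ring

theorem mfderiv_symm_mfderiv (φ : Diffeo n M) (p : M) (v : EuclideanSpace ℝ (Fin (n + 1))) :
    mfderiv (𝓡 (n + 1)) (𝓡 (n + 1)) φ.symm (φ p)
      (mfderiv (𝓡 (n + 1)) (𝓡 (n + 1)) φ p v) = v := by
  have h := mfderiv_comp_apply p (φ.symm.contMDiff.mdifferentiableAt (x := φ p) (by simp))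
    (φ.contMDiff.mdifferentiableAt (x := p) (by simp)) v
  have h2 : φ.symm ∘ φ = id := funext φ.symm_apply_apply
  rw [h2, mfderiv_id] at h
  exact h.symm

/-- The pull-back of a Riemannian metric by a diffeomorphism. -/
def pullbackMetric (φ : Diffeo n M) (g : Metric n M) : Metric n M :=
  metricOfBilin
    (fun q => (ContinuousLinearMap.precomp ℝ (mfderiv (𝓡 (n + 1)) (𝓡 (n + 1)) φ q)).comp
      ((g.inner (φ q)).comp (mfderiv (𝓡 (n + 1)) (𝓡 (n + 1)) φ q)))
    (fun q v w => g.symm (φ q) _ _)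
    (fun q v hv => g.pos (φ q) _ fun h => hv (by
      exact (mfderiv_symm_mfderiv φ q v).symm.trans ((congrArg
        (mfderiv (𝓡 (n + 1)) (𝓡 (n + 1)) φ.symm (φ q)) h).trans (map_zero _))))
    (fun p Y Z hY hZ => by
      have hΦ : ContMDiffAt ((𝓡 (n + 1)).prod (𝓡 (n + 1))) (𝓡 (n + 1)) ∞
          (Function.uncurry fun _ : M => φ) (p, p) :=
        (φ.contMDiff.comp contMDiff_snd).contMDiffAt
      exact contMDiffAt_bilin_apply (g.contMDiff (φ p))
        (contMDiffAt_mfderiv_apply (b := id) hΦ contMDiffAt_id hY)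
        (contMDiffAt_mfderiv_apply (b := id) hΦ contMDiffAt_id hZ))

theorem pullbackMetric_inner (φ : Diffeo n M) (g : Metric n M) (p : M)
    (v w : TangentSpace (𝓡 (n + 1)) p) :
    (pullbackMetric φ g).inner p v w =
      g.inner (φ p) (mfderiv (𝓡 (n + 1)) (𝓡 (n + 1)) φ p v)
        (mfderiv (𝓡 (n + 1)) (𝓡 (n + 1)) φ p w) :=
  rfl

theorem isAdapted_pullbackMetric {φ : Diffeo n M} (hφ : PreservesFN 𝓕 φ) (hg : IsAdapted 𝓕 g) :
    IsAdapted 𝓕 (pullbackMetric φ g) := fun p => by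
  refine ⟨?_, fun v hv => ?_⟩
  · rw [pullbackMetric_inner, (hφ p).2, (hg _).1]
  · rw [pullbackMetric_inner, (hφ p).2]
    exact (hg _).2 _ ((hφ p).1 ▸ Submodule.mem_map_of_mem hv)

theorem mfderiv_hat {φ : Diffeo n M} (hφ : PreservesFN 𝓕 φ) (p : M)
    (v : TangentSpace (𝓡 (n + 1)) p) :
    mfderiv (𝓡 (n + 1)) (𝓡 (n + 1)) φ p (hat 𝓕 (pullbackMetric φ g) p v) =
      hat 𝓕 g (φ p) (mfderiv (𝓡 (n + 1)) (𝓡 (n + 1)) φ p v) := by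
  rw [hat_apply, hat_apply, map_sub, map_smul, (hφ p).2, pullbackMetric_inner, (hφ p).2]

theorem truncated_pullbackMetric {φ : Diffeo n M} (hφ : PreservesFN 𝓕 φ) (p : M)
    (v w : TangentSpace (𝓡 (n + 1)) p) :
    truncated 𝓕 (pullbackMetric φ g) p v w = pullback φ (truncated 𝓕 g) p v w := by
  rw [truncated, pullbackMetric_inner, mfderiv_hat hφ, mfderiv_hat hφ]
  rfl

end Metrics

/-! ### The Levi-Civita connection under leafwise rescaling -/

section LeviCivita

open Filter Topology VectorField

variable {n : ℕ} {M : Type*} [TopologicalSpace M]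
  [ChartedSpace (EuclideanSpace ℝ (Fin (n + 1))) M] [IsManifold (𝓡 (n + 1)) ∞ M]
  {𝓕 : OrientedFoliation n M} {g : Metric n M} {nabla : Connection n M} {p : M}

/-- For a local submersion u defining the leaves, [Y,Z]u = Y(Zu) − Z(Yu) = 0. -/
theorem mlieBracket_mem_tangent {Y Z : VectorField n M} (hY : MDiffField Y p)
    (hZ : MDiffField Z p) (hYT : ∀ q, Y q ∈ 𝓕.tangent q) (hZT : ∀ q, Z q ∈ 𝓕.tangent q) :
    mlieBracket (𝓡 (n + 1)) Y Z p ∈ 𝓕.tangent p := by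
  obtain ⟨U, hUo, hpU, u, hus, hu⟩ := 𝓕.locally_submersion p
  have hU := hUo.mem_nhds hpU
  have h0 : ∀ W : VectorField n M, (∀ q, W q ∈ 𝓕.tangent q) →
      mvfderiv (𝓡 (n + 1)) (fun q => mvfderiv (𝓡 (n + 1)) u q (W q)) p = 0 := by
    intro W hW
    have : (fun q => mvfderiv (𝓡 (n + 1)) u q (W q)) =ᶠ[𝓝 p] fun _ => (0 : ℝ) := by
      filter_upwards [hU] with q hq
      exact ((hu q hq).2 _).1 (hW q)
    rw [mvfderiv_congr this, mvfderiv_const]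
  rw [(hu p hpU).2, mvfderiv_mlieBracket ((hus.contMDiffAt hU).of_le two_le_infty) hY hZ,
    h0 Y hYT, h0 Z hZT, zero_apply, zero_apply, sub_zero]

theorem IsLeviCivita.inner_nabla_normal_normal (h : IsLeviCivita g nabla) (hg : IsAdapted 𝓕 g)
    (v : TangentSpace (𝓡 (n + 1)) p) :
    g.inner p (nabla 𝓕.normal p v) (𝓕.normal p) = 0 := by
  have h1 := h.2 p 𝓕.normal 𝓕.normal (𝓕.smooth_normal.mDiffField p)
    (𝓕.smooth_normal.mDiffField p) v
  have h2 : (fun q => g.inner q (𝓕.normal q) (𝓕.normal q)) = fun _ => 1 :=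
    funext fun q => (hg q).1
  rw [h2, mvfderiv_const, zero_apply, g.symm p (𝓕.normal p)] at h1
  linarith

/-- The second fundamental form is symmetric. -/
theorem IsLeviCivita.inner_nabla_normal_symm [T2Space M] (h : IsLeviCivita g nabla)
    (hg : IsAdapted 𝓕 g) {v w : TangentSpace (𝓡 (n + 1)) p} (hv : v ∈ 𝓕.tangent p)
    (hw : w ∈ 𝓕.tangent p) :
    g.inner p (nabla 𝓕.normal p v) w = g.inner p (nabla 𝓕.normal p w) v := by
  obtain ⟨Y, hY, hYT, rfl⟩ := hg.exists_smoothField_mem hv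
  obtain ⟨Z, hZ, hZT, rfl⟩ := hg.exists_smoothField_mem hw
  have hN := 𝓕.smooth_normal.mDiffField p
  -- Differentiating g(N,W) = 0 moves the derivative from N to W; then the asymmetry is g([Y,Z],N),
  -- which vanishes by integrability.
  have key : ∀ W : VectorField n M, SmoothField W → (∀ q, W q ∈ 𝓕.tangent q) →
      ∀ a : TangentSpace (𝓡 (n + 1)) p,
      0 = g.inner p (nabla 𝓕.normal p a) (W p) + g.inner p (nabla W p a) (𝓕.normal p) := by
    intro W hW hWT a
    have h1 := h.2 p 𝓕.normal W hN (hW.mDiffField p) a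
    have h2 : (fun q => g.inner q (𝓕.normal q) (W q)) = fun _ => 0 :=
      funext fun q => (g.symm q _ _).trans ((hg q).2 _ (hWT q))
    rwa [h2, mvfderiv_const, zero_apply, g.symm p (𝓕.normal p)] at h1
  have h1 := key Z hZ hZT (Y p)
  have h2 := key Y hY hYT (Z p)
  have h3 := (CovariantDerivative.torsion_eq_zero_iff _).1 h.1 (hY.mDiffField p) (hZ.mDiffField p)
  have h4 := (hg p).2 _ (mlieBracket_mem_tangent (hY.mDiffField p) (hZ.mDiffField p) hYT hZT)
  rw [← h3, map_sub, sub_apply] at h4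
  linarith

/-- The difference of the Levi-Civita connections of `c ĝ + g(·, N) g(·, N)` and `g`. -/
def rescaleDifference (𝓕 : OrientedFoliation n M) (g : Metric n M) (nabla : Connection n M)
    (c : ℝ) (p : M) : TangentSpace (𝓡 (n + 1)) p →L[ℝ]
      TangentSpace (𝓡 (n + 1)) p →L[ℝ] TangentSpace (𝓡 (n + 1)) p :=
  haveI : T2Space (TangentSpace (𝓡 (n + 1)) p) :=
    inferInstanceAs (T2Space (EuclideanSpace ℝ (Fin (n + 1))))
  haveI : FiniteDimensional ℝ (TangentSpace (𝓡 (n + 1)) p) :=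
    inferInstanceAs (FiniteDimensional ℝ (EuclideanSpace ℝ (Fin (n + 1))))
  let B : TangentSpace (𝓡 (n + 1)) p →ₗ[ℝ] TangentSpace (𝓡 (n + 1)) p →ₗ[ℝ]
      TangentSpace (𝓡 (n + 1)) p :=
    LinearMap.mk₂ ℝ (fun y v =>
      -- For leafwise v and y the normal component −g(∇_v N, y) of ∇_v y acquires the factor c,
      -- whence 1 − c. For leafwise W, g(∇_N N, W) = −g([N,W],N) is the same for all adapted
      -- metrics, so ∇_N N is divided by c, whence c⁻¹ − 1 = (1 − c)c⁻¹. Mixed terms do not change.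
      ((1 - c) * g.inner p (nabla 𝓕.normal p (hat 𝓕 g p v)) (hat 𝓕 g p y)) • 𝓕.normal p +
      ((1 - c) * c⁻¹ * g.inner p v (𝓕.normal p) * g.inner p y (𝓕.normal p)) •
        nabla 𝓕.normal p (𝓕.normal p))
      (fun y y' v => by simp only [map_add, add_apply]; module)
      (fun a y v => by simp only [map_smul, smul_apply, smul_eq_mul]; module)
      (fun y v v' => by simp only [map_add, add_apply]; module)
      (fun a y v => by simp only [map_smul, smul_apply, smul_eq_mul]; module)
  LinearMap.toContinuousLinearMap (LinearMap.toContinuousLinearMap.toLinearMap ∘ₗ B)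

theorem rescaleDifference_apply (c : ℝ) (y v : TangentSpace (𝓡 (n + 1)) p) :
    rescaleDifference 𝓕 g nabla c p y v =
      ((1 - c) * g.inner p (nabla 𝓕.normal p (hat 𝓕 g p v)) (hat 𝓕 g p y)) • 𝓕.normal p +
      ((1 - c) * c⁻¹ * g.inner p v (𝓕.normal p) * g.inner p y (𝓕.normal p)) •
        nabla 𝓕.normal p (𝓕.normal p) :=
  rfl

/-- The Levi-Civita connection of `c ĝ + g(·, N) g(·, N)`. -/
def rescaleConnection (𝓕 : OrientedFoliation n M) (g : Metric n M) (nabla : Connection n M)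
    (c : ℝ) : Connection n M :=
  nabla.addOneForm (rescaleDifference 𝓕 g nabla c)

theorem rescaleConnection_apply (c : ℝ) (Y : VectorField n M)
    (v : TangentSpace (𝓡 (n + 1)) p) :
    rescaleConnection 𝓕 g nabla c Y p v =
      nabla Y p v + rescaleDifference 𝓕 g nabla c p (Y p) v :=
  rfl

theorem inner_hat_of_inner_normal_eq_zero {v : TangentSpace (𝓡 (n + 1)) p}
    (hv : g.inner p v (𝓕.normal p) = 0) (w : TangentSpace (𝓡 (n + 1)) p) :
    g.inner p v (hat 𝓕 g p w) = g.inner p v w := by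
  rw [hat_apply, map_sub, map_smul, hv, smul_zero, sub_zero]

/-- Torsion stays zero because the difference tensor is symmetric, by symmetry of the second
fundamental form. Compatibility is a direct computation using g(∇N, N) = 0. -/
theorem IsLeviCivita.rescale [T2Space M] (h : IsLeviCivita g nabla) (hg : IsAdapted 𝓕 g) {c : ℝ}
    (hc : 0 < c) : IsLeviCivita (hg.rescale hc) (rescaleConnection 𝓕 g nabla c) := by
  refine ⟨(CovariantDerivative.torsion_eq_zero_iff _).2 fun {Y Z p} hY hZ => ?_,
    fun p Y Z hY hZ v => ?_⟩
  · rw [← (CovariantDerivative.torsion_eq_zero_iff _).1 h.1 hY hZ, rescaleConnection_apply,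
      rescaleConnection_apply, rescaleDifference_apply, rescaleDifference_apply,
      h.inner_nabla_normal_symm hg (hg.hat_mem (Y p)) (hg.hat_mem (Z p))]
    module
  · have hN := 𝓕.smooth_normal.mDiffField p
    have h1 := (mdifferentiableAt_inner g hY hZ).hasMFDerivAt
    have h2 := (mdifferentiableAt_inner g hY hN).hasMFDerivAt
    have h3 := (mdifferentiableAt_inner g hZ hN).hasMFDerivAt
    have h4 : HasMFDerivAt (𝓡 (n + 1)) 𝓘(ℝ, ℝ) (fun q => (hg.rescale hc).inner q (Y q) (Z q)) p _ :=
      ((h1.const_smul c).add ((h2.mul h3).const_smul (1 - c))).congr_of_eventuallyEq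
        (Eventually.of_forall fun q => hg.rescale_inner hc q (Y q) (Z q))
    have h5 := congrArg (fun L : EuclideanSpace ℝ (Fin (n + 1)) →L[ℝ] ℝ => L v) h4.mfderiv
    have key : ∀ (A B C : EuclideanSpace ℝ (Fin (n + 1)) →L[ℝ] ℝ) (b d : ℝ)
        (v : EuclideanSpace ℝ (Fin (n + 1))),
        (c • A + (1 - c) • (b • C + d • B)) v = c * A v + (1 - c) * (b * C v + d * B v) := by
      intro A B C b d v
      simp only [add_apply, smul_apply, smul_eq_mul]
    refine (h5.trans (key _ _ _ _ _ v)).trans ?_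
    have e1 := h.2 p Y Z hY hZ v
    have e2 := h.2 p Y 𝓕.normal hY hN v
    have e3 := h.2 p Z 𝓕.normal hZ hN v
    refine (congrArg₂ (fun a b : ℝ => c * a + (1 - c) * b) e1 (congrArg₂ (fun a b : ℝ =>
      g.inner p (Y p) (𝓕.normal p) * a + g.inner p (Z p) (𝓕.normal p) * b) e3 e2)).trans ?_
    have s0 : ∀ w, g.inner p (𝓕.normal p) w = g.inner p w (𝓕.normal p) := g.symm p _
    have s1 : g.inner p (Y p) (nabla Z p v) = g.inner p (nabla Z p v) (Y p) := g.symm p _ _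
    have s2 : ∀ w, g.inner p w (nabla 𝓕.normal p v) =
        g.inner p (nabla 𝓕.normal p (hat 𝓕 g p v)) w +
        g.inner p v (𝓕.normal p) * g.inner p (nabla 𝓕.normal p (𝓕.normal p)) w := by
      intro w
      have : v = hat 𝓕 g p v + g.inner p v (𝓕.normal p) • 𝓕.normal p := by
        rw [hat_apply, sub_add_cancel]
      conv_lhs => rw [this]
      rw [map_add, map_smul, g.symm p w, map_add, map_smul, add_apply, smul_apply, smul_eq_mul]
    have hn : ∀ v, g.inner p (nabla 𝓕.normal p v) (𝓕.normal p) = 0 :=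
      fun v => h.inner_nabla_normal_normal hg v
    simp only [rescaleConnection_apply, rescaleDifference_apply, hg.rescale_inner,
      inner_hat_of_inner_normal_eq_zero (hn _), map_add, map_smul, add_apply, smul_apply,
      smul_eq_mul, hn, (hg p).1, s0, s1, s2, g.symm p (Y p) (nabla 𝓕.normal p (𝓕.normal p))]
    field_simp
    ring

/-- The difference tensor vanishes on the pair (N, v̂): one term contains the leafwise part of N,
the other g(v̂,N). -/
theorem weingarten_rescale (hg : IsAdapted 𝓕 g) {c : ℝ} (hc : 0 < c) (p : M) :
    weingarten 𝓕 (hg.rescale hc) (rescaleConnection 𝓕 g nabla c) p = weingarten 𝓕 g nabla p := by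
  ext1 v
  have h1 : rescaleDifference 𝓕 g nabla c p (𝓕.normal p) (hat 𝓕 g p v) = 0 := by
    rw [rescaleDifference_apply, hg.hat_normal, map_zero, hg.inner_hat_normal]
    simp
  have h2 : nabla 𝓕.normal p (hat 𝓕 g p v) +
      rescaleDifference 𝓕 g nabla c p (𝓕.normal p) (hat 𝓕 g p v) =
      nabla 𝓕.normal p (hat 𝓕 g p v) := by
    rw [h1, add_zero]
  rw [weingarten, (hg.isAdapted_rescale hc).hat_eq hg]
  exact congrArg Neg.neg h2

/-- A and the τ_j are unchanged and each b̂_j is linear in ĝ. This is what makes the factor e^{εt}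
compatible with the flow. -/
theorem hTensor_rescale (f : Fin n → (Fin n → ℝ) → ℝ) (hg : IsAdapted 𝓕 g) {c : ℝ} (hc : 0 < c)
    (p : M) (v w : TangentSpace (𝓡 (n + 1)) p) :
    hTensor f 𝓕 (hg.rescale hc) (rescaleConnection 𝓕 g nabla c) p v w =
      c * hTensor f 𝓕 g nabla p v w := by
  have htau : tau 𝓕 (hg.rescale hc) (rescaleConnection 𝓕 g nabla c) p = tau 𝓕 g nabla p := by
    funext i
    simp only [tau, weingarten_rescale]
  simp only [hTensor, htau, bHat, weingarten_rescale, hg.truncated_rescale, Finset.mul_sum]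
  exact Finset.sum_congr rfl fun j _ => by ring

end LeviCivita

/-! ### Naturality of the connection and of h under diffeomorphisms -/

section PullbackConnection

open Filter Topology VectorField

variable {n : ℕ} {M : Type*} [TopologicalSpace M]
  [ChartedSpace (EuclideanSpace ℝ (Fin (n + 1))) M] [IsManifold (𝓡 (n + 1)) ∞ M]
  {𝓕 : OrientedFoliation n M} {g : Metric n M} {nabla : Connection n M} {p : M} {φ : Diffeo n M}

/-- The differential of a diffeomorphism, as a linear equivalence. -/
def tangentEquiv (φ : Diffeo n M) (p : M) :
    TangentSpace (𝓡 (n + 1)) p ≃L[ℝ] TangentSpace (𝓡 (n + 1)) (φ p) :=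
  φ.mfderivToContinuousLinearEquiv (by simp) p

theorem tangentEquiv_apply (v : TangentSpace (𝓡 (n + 1)) p) :
    tangentEquiv φ p v = mfderiv (𝓡 (n + 1)) (𝓡 (n + 1)) φ p v :=
  rfl

theorem isInvertible_mfderiv (φ : Diffeo n M) (p : M) :
    (mfderiv (𝓡 (n + 1)) (𝓡 (n + 1)) φ p).IsInvertible :=
  ⟨tangentEquiv φ p, rfl⟩

/-- The push-forward of a vector field by a diffeomorphism. -/
def pushforward (φ : Diffeo n M) (Y : VectorField n M) : VectorField n M :=
  mpullback (𝓡 (n + 1)) (𝓡 (n + 1)) φ.symm Y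

theorem pushforward_apply (Y : VectorField n M) :
    pushforward φ Y (φ p) = tangentEquiv φ p (Y p) := by
  have h1 : (mfderiv (𝓡 (n + 1)) (𝓡 (n + 1)) φ.symm (φ p)).inverse =
      (tangentEquiv φ.symm (φ p)).symm :=
    ContinuousLinearMap.inverse_equiv (tangentEquiv φ.symm (φ p))
  rw [pushforward, mpullback_apply, h1]
  refine (ContinuousLinearEquiv.symm_apply_eq _).2 ?_
  have h2 : (Y (φ.symm (φ p)) : EuclideanSpace ℝ (Fin (n + 1))) = Y p :=
    congrArg (fun q => (Y q : EuclideanSpace ℝ (Fin (n + 1)))) (φ.symm_apply_apply p)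
  exact h2.trans (mfderiv_symm_mfderiv φ p (Y p)).symm

theorem MDiffField.pushforward {Y : VectorField n M} (hY : MDiffField Y p) :
    MDiffField (pushforward φ Y) (φ p) := by
  refine MDifferentiableAt.mpullback_vectorField (n := ∞) ?_ φ.symm.contMDiff.contMDiffAt
    (isInvertible_mfderiv φ.symm (φ p)) two_le_infty
  rw [φ.symm_apply_apply]
  exact hY

theorem pushforward_mlieBracket {Y Z : VectorField n M} (hY : MDiffField Y p)
    (hZ : MDiffField Z p) :
    tangentEquiv φ p (mlieBracket (𝓡 (n + 1)) Y Z p) =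
      mlieBracket (𝓡 (n + 1)) (pushforward φ Y) (pushforward φ Z) (φ p) := by
  rw [← pushforward_apply (mlieBracket (𝓡 (n + 1)) Y Z)]
  have : IsManifold (𝓡 (n + 1)) (minSmoothness ℝ 2) M := by
    rw [minSmoothness_of_isRCLikeNormedField]
    infer_instance
  refine mpullback_mlieBracket (n := ∞) ?_ ?_ φ.symm.contMDiff.contMDiffAt (by
    rw [minSmoothness_of_isRCLikeNormedField]; exact two_le_infty)
  · rw [φ.symm_apply_apply]
    exact hY
  · rw [φ.symm_apply_apply]
    exact hZ

theorem pushforward_normal (hφ : PreservesFN 𝓕 φ) :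
    pushforward φ 𝓕.normal = 𝓕.normal := by
  funext q
  obtain ⟨p, rfl⟩ := φ.surjective q
  exact (pushforward_apply 𝓕.normal).trans (hφ p).2

theorem mvfderiv_comp_diffeo {u : M → ℝ} (hu : MDifferentiableAt (𝓡 (n + 1)) 𝓘(ℝ, ℝ) u (φ p))
    (v : TangentSpace (𝓡 (n + 1)) p) :
    mvfderiv (𝓡 (n + 1)) (fun q => u (φ q)) p v =
      mvfderiv (𝓡 (n + 1)) u (φ p) (tangentEquiv φ p v) :=
  mfderiv_comp_apply p hu (φ.contMDiff.mdifferentiableAt (by simp)) v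

/-- The pull-back of a connection by a diffeomorphism. -/
def pullbackConnection (φ : Diffeo n M) (nabla : Connection n M) : Connection n M where
  toFun Y p := ((tangentEquiv φ p).symm : TangentSpace (𝓡 (n + 1)) (φ p) →L[ℝ]
    TangentSpace (𝓡 (n + 1)) p).comp ((nabla (pushforward φ Y) (φ p)).comp
      (tangentEquiv φ p : TangentSpace (𝓡 (n + 1)) p →L[ℝ] TangentSpace (𝓡 (n + 1)) (φ p)))
  isCovariantDerivativeOnUniv :=
    { add := fun {Y Z p} hY hZ _ => by
        have h1 : EGF.pushforward φ (Y + Z) = EGF.pushforward φ Y + EGF.pushforward φ Z :=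
          mpullback_add
        have h2 := nabla.isCovariantDerivativeOnUniv.add (MDiffField.pushforward (φ := φ) hY)
          (MDiffField.pushforward (φ := φ) hZ)
        rw [h1, h2]
        ext1 v
        simp
      leibniz := fun {Y u p} hY hu _ => by
        have h1 : EGF.pushforward φ (u • Y) = (u ∘ φ.symm) • EGF.pushforward φ Y :=
          mpullback_smul
        have hu' : MDifferentiableAt (𝓡 (n + 1)) 𝓘(ℝ, ℝ) (u ∘ φ.symm) (φ p) := by
          refine MDifferentiableAt.comp (φ p) ?_ (φ.symm.contMDiff.mdifferentiableAt (by simp))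
          rw [φ.symm_apply_apply]
          exact hu
        have h2 := nabla.isCovariantDerivativeOnUniv.leibniz
          (MDiffField.pushforward (φ := φ) hY) hu'
        rw [h1, h2]
        ext1 v
        have h3 := mvfderiv_comp_diffeo hu' v
        simp only [Function.comp_apply, φ.symm_apply_apply] at h3
        simp only [ContinuousLinearMap.comp_apply, add_apply, smul_apply,
          ContinuousLinearMap.smulRight_apply, map_add, map_smul, ContinuousLinearEquiv.coe_coe,
          pushforward_apply, ContinuousLinearEquiv.symm_apply_apply, Function.comp_apply,
          φ.symm_apply_apply]
        rw [← h3] }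

theorem pullbackConnection_apply (Y : VectorField n M) (v : TangentSpace (𝓡 (n + 1)) p) :
    pullbackConnection φ nabla Y p v =
      (tangentEquiv φ p).symm (nabla (pushforward φ Y) (φ p) (tangentEquiv φ p v)) :=
  rfl

/-- Both conditions are transported by φ: push-forward respects brackets, and derivatives of
functions obey the chain rule. -/
theorem IsLeviCivita.pullback (h : IsLeviCivita g nabla) (φ : Diffeo n M) :
    IsLeviCivita (pullbackMetric φ g) (pullbackConnection φ nabla) := by
  refine ⟨(CovariantDerivative.torsion_eq_zero_iff _).2 fun {Y Z p} hY hZ => ?_,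
    fun p Y Z hY hZ v => ?_⟩
  · rw [pullbackConnection_apply, pullbackConnection_apply, ← map_sub, ← pushforward_apply,
      ← pushforward_apply, (CovariantDerivative.torsion_eq_zero_iff _).1 h.1
      (MDiffField.pushforward hY) (MDiffField.pushforward hZ), ← pushforward_mlieBracket hY hZ,
      ContinuousLinearEquiv.symm_apply_apply]
  · have hY' := MDiffField.pushforward (φ := φ) hY
    have hZ' := MDiffField.pushforward (φ := φ) hZ
    have h1 : (fun q => (pullbackMetric φ g).inner q (Y q) (Z q)) =
        fun q => (fun q => g.inner q (EGF.pushforward φ Y q) (EGF.pushforward φ Z q)) (φ q) := by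
      funext q
      rw [pullbackMetric_inner]
      simp only [pushforward_apply]
      rfl
    rw [h1, mvfderiv_comp_diffeo (mdifferentiableAt_inner g hY' hZ'), h.2 _ _ _ hY' hZ',
      pushforward_apply, pushforward_apply, pullbackMetric_inner, pullbackMetric_inner,
      pullbackConnection_apply, pullbackConnection_apply, ← tangentEquiv_apply,
      ← tangentEquiv_apply, ← tangentEquiv_apply, ← tangentEquiv_apply,
      ContinuousLinearEquiv.apply_symm_apply, ContinuousLinearEquiv.apply_symm_apply]

/-- N is φ-invariant and dφ intertwines the projections to T𝓕, so dφ conjugates the Weingarten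
operators; equality of the τ_j and naturality of h follow. -/
theorem weingarten_pullback (hφ : PreservesFN 𝓕 φ) (v : TangentSpace (𝓡 (n + 1)) p) :
    tangentEquiv φ p (weingarten 𝓕 (pullbackMetric φ g) (pullbackConnection φ nabla) p v) =
      weingarten 𝓕 g nabla (φ p) (tangentEquiv φ p v) := by
  have h1 : tangentEquiv φ p (pullbackConnection φ nabla 𝓕.normal p
      (hat 𝓕 (pullbackMetric φ g) p v)) =
      nabla 𝓕.normal (φ p) (hat 𝓕 g (φ p) (tangentEquiv φ p v)) := by
    rw [pullbackConnection_apply, pushforward_normal hφ,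
      ContinuousLinearEquiv.apply_symm_apply, tangentEquiv_apply, mfderiv_hat hφ]
    rfl
  exact (map_neg _ _).trans (congrArg Neg.neg h1)

theorem weingarten_pullback_pow (hφ : PreservesFN 𝓕 φ) (j : ℕ) (v : TangentSpace (𝓡 (n + 1)) p) :
    tangentEquiv φ p
        ((weingarten 𝓕 (pullbackMetric φ g) (pullbackConnection φ nabla) p ^ j) v) =
      (weingarten 𝓕 g nabla (φ p) ^ j) (tangentEquiv φ p v) := by
  induction j generalizing v with
  | zero => rfl
  | succ j ih =>
    rw [pow_succ, pow_succ, Module.End.mul_apply, Module.End.mul_apply, ih,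
      weingarten_pullback hφ]

theorem tau_pullback (hφ : PreservesFN 𝓕 φ) (p : M) :
    tau 𝓕 (pullbackMetric φ g) (pullbackConnection φ nabla) p = tau 𝓕 g nabla (φ p) := by
  funext i
  have h : weingarten 𝓕 g nabla (φ p) ^ ((i : ℕ) + 1) =
      (tangentEquiv φ p).toLinearEquiv.conj
        (weingarten 𝓕 (pullbackMetric φ g) (pullbackConnection φ nabla) p ^ ((i : ℕ) + 1)) := by
    ext1 w
    obtain ⟨v, rfl⟩ := (tangentEquiv φ p).surjective w
    rw [← weingarten_pullback_pow hφ, LinearEquiv.conj_apply_apply]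
    exact congrArg (fun v => tangentEquiv φ p ((weingarten 𝓕 (pullbackMetric φ g)
      (pullbackConnection φ nabla) p ^ ((i : ℕ) + 1)) v))
      ((tangentEquiv φ p).symm_apply_apply v).symm
  rw [tau, tau, h, LinearMap.trace_conj']

theorem hTensor_pullback (f : Fin n → (Fin n → ℝ) → ℝ) (hφ : PreservesFN 𝓕 φ)
    (v w : TangentSpace (𝓡 (n + 1)) p) :
    hTensor f 𝓕 (pullbackMetric φ g) (pullbackConnection φ nabla) p v w =
      hTensor f 𝓕 g nabla (φ p) (tangentEquiv φ p v) (tangentEquiv φ p w) := by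
  simp only [hTensor, tau_pullback hφ, bHat, truncated_pullbackMetric hφ, EGF.pullback,
    ← weingarten_pullback_pow hφ]
  rfl

end PullbackConnection

/-! ### Part (b): the solution generated by a soliton structure -/

section Existence

open Filter Topology VectorField

variable {n : ℕ} {M : Type*} [TopologicalSpace M]
  [ChartedSpace (EuclideanSpace ℝ (Fin (n + 1))) M] [IsManifold (𝓡 (n + 1)) ∞ M]
  {f : Fin n → (Fin n → ℝ) → ℝ} {𝓕 : OrientedFoliation n M} {g : Metric n M}
  {X : VectorField n M} {ψ : ℝ → Diffeo n M} {ε : ℝ}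

theorem metric_ext {g g' : Metric n M} (h : ∀ p v w, g.inner p v w = g'.inner p v w) : g = g' := by
  have h' : g.inner = g'.inner := by
    funext p
    ext v w
    exact h p v w
  cases g
  cases g'
  congr

/-- The metrics `e^{ε t} ψ_t^* ĝ + ψ_t^*(g(·, N) g(·, N))`. -/
def solitonFamily (hg : IsAdapted 𝓕 g) (ε : ℝ) (ψ : ℝ → Diffeo n M) (t : ℝ) : Metric n M :=
  pullbackMetric (ψ t) (hg.rescale (Real.exp_pos (ε * t)))

namespace IsFlowOf

theorem solitonFamily_zero (h : IsFlowOf X ψ) (hg : IsAdapted 𝓕 g) :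
    solitonFamily hg ε ψ 0 = g := by
  refine metric_ext fun p v w => ?_
  change (hg.rescale (Real.exp_pos (ε * 0))).inner (ψ 0 p) (h.deriv 0 p v) (h.deriv 0 p w) = _
  rw [h.deriv_zero, h.zero]
  refine (hg.rescale_inner _ p v w).trans ?_
  rw [mul_zero, Real.exp_zero]
  ring

theorem isAdapted_solitonFamily [T2Space M] (h : IsFlowOf X ψ) (hX : FieldPreservesFN 𝓕 X)
    (hg : IsAdapted 𝓕 g) (t : ℝ) : IsAdapted 𝓕 (solitonFamily hg ε ψ t) :=
  isAdapted_pullbackMetric (h.preservesFN hX hg t) (hg.isAdapted_rescale _)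

theorem truncated_solitonFamily [T2Space M] (h : IsFlowOf X ψ) (hX : FieldPreservesFN 𝓕 X)
    (hg : IsAdapted 𝓕 g) (t : ℝ) (p : M) (v w : TangentSpace (𝓡 (n + 1)) p) :
    truncated 𝓕 (solitonFamily hg ε ψ t) p v w =
      Real.exp (ε * t) * pullback (ψ t) (truncated 𝓕 g) p v w := by
  rw [solitonFamily, truncated_pullbackMetric (h.preservesFN hX hg t)]
  exact hg.truncated_rescale _ _ _ _

/-- Each metric of the family is adapted, so its normal part is that of g and only the truncated
part depends on t. -/
theorem solitonFamily_inner [T2Space M] (h : IsFlowOf X ψ) (hX : FieldPreservesFN 𝓕 X)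
    (hg : IsAdapted 𝓕 g) (t : ℝ) (p : M) (v w : TangentSpace (𝓡 (n + 1)) p) :
    (solitonFamily hg ε ψ t).inner p v w =
      Real.exp (ε * t) * pullback (ψ t) (truncated 𝓕 g) p v w +
        g.inner p v (𝓕.normal p) * g.inner p w (𝓕.normal p) := by
  have ht := h.isAdapted_solitonFamily (ε := ε) hX hg t
  rw [← h.truncated_solitonFamily hX hg, ht.truncated_apply, ht.inner_normal_eq hg,
    ht.inner_normal_eq hg, sub_add_cancel]

theorem contMDiff_uncurry (h : IsFlowOf X ψ) :
    ContMDiff (𝓘(ℝ, ℝ).prod (𝓡 (n + 1))) (𝓡 (n + 1)) ∞ (fun q : ℝ × M => ψ q.1 q.2) := by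
  rw [← contMDiffOn_univ, ← univ_prod_univ]
  exact h.smooth

theorem contMDiffAt_mfderiv_apply (h : IsFlowOf X ψ) (z : ℝ × M) {Y : VectorField n M}
    (hY : ContMDiffAt (𝓡 (n + 1)) (𝓡 (n + 1)).tangent ∞
      (fun q => (⟨q, Y q⟩ : TangentBundle (𝓡 (n + 1)) M)) z.2) :
    ContMDiffAt (𝓘(ℝ, ℝ).prod (𝓡 (n + 1))) (𝓡 (n + 1)).tangent ∞
      (fun z : ℝ × M => (⟨ψ z.1 z.2, mfderiv (𝓡 (n + 1)) (𝓡 (n + 1)) (ψ z.1) z.2 (Y z.2)⟩ :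
        TangentBundle (𝓡 (n + 1)) M)) z := by
  have hΦ : ContMDiffAt ((𝓘(ℝ, ℝ).prod (𝓡 (n + 1))).prod (𝓡 (n + 1))) (𝓡 (n + 1)) ∞
      (Function.uncurry fun (z : ℝ × M) (q : M) => ψ z.1 q) (z, z.2) :=
    (h.contMDiff_uncurry.comp
      ((contMDiff_fst.comp contMDiff_fst).prodMk contMDiff_snd)).contMDiffAt
  exact EGF.contMDiffAt_mfderiv_apply hΦ contMDiffAt_snd hY

theorem contMDiffAt_solitonFamily_inner_apply (h : IsFlowOf X ψ) (hg : IsAdapted 𝓕 g) (z : ℝ × M)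
    {Y Z : VectorField n M}
    (hY : ContMDiffAt (𝓡 (n + 1)) (𝓡 (n + 1)).tangent ∞
      (fun q => (⟨q, Y q⟩ : TangentBundle (𝓡 (n + 1)) M)) z.2)
    (hZ : ContMDiffAt (𝓡 (n + 1)) (𝓡 (n + 1)).tangent ∞
      (fun q => (⟨q, Z q⟩ : TangentBundle (𝓡 (n + 1)) M)) z.2) :
    ContMDiffAt (𝓘(ℝ, ℝ).prod (𝓡 (n + 1))) 𝓘(ℝ, ℝ) ∞
      (fun z : ℝ × M => (solitonFamily hg ε ψ z.1).inner z.2 (Y z.2) (Z z.2)) z := by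
  have hY' := h.contMDiffAt_mfderiv_apply z hY
  have hZ' := h.contMDiffAt_mfderiv_apply z hZ
  have hN' : ContMDiffAt (𝓘(ℝ, ℝ).prod (𝓡 (n + 1))) (𝓡 (n + 1)).tangent ∞
      (fun z : ℝ × M => (⟨ψ z.1 z.2, 𝓕.normal (ψ z.1 z.2)⟩ : TangentBundle (𝓡 (n + 1)) M)) z :=
    (𝓕.smooth_normal.comp h.contMDiff_uncurry) z
  have hc : ContMDiffAt (𝓘(ℝ, ℝ).prod (𝓡 (n + 1))) 𝓘(ℝ, ℝ) ∞
      (fun z : ℝ × M => Real.exp (ε * z.1)) z :=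
    ((Real.contDiff_exp.comp (contDiff_const.mul contDiff_id)).contMDiff.comp
      contMDiff_fst).contMDiffAt
  have hgψ := g.contMDiff (ψ z.1 z.2)
  have h1 := contMDiffAt_bilin_apply (b := fun z : ℝ × M => ψ z.1 z.2) hgψ hY' hZ'
  have h2 := contMDiffAt_bilin_apply (b := fun z : ℝ × M => ψ z.1 z.2) hgψ hY' hN'
  have h3 := contMDiffAt_bilin_apply (b := fun z : ℝ × M => ψ z.1 z.2) hgψ hZ' hN'
  have h4 := (hc.mul h1).add (((contMDiffAt_const (c := (1 : ℝ))).sub hc).mul (h2.mul h3))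
  refine h4.congr_of_eventuallyEq (.of_forall fun z => ?_)
  exact hg.rescale_inner (Real.exp_pos (ε * z.1)) (ψ z.1 z.2)
    (mfderiv (𝓡 (n + 1)) (𝓡 (n + 1)) (ψ z.1) z.2 (Y z.2))
    (mfderiv (𝓡 (n + 1)) (𝓡 (n + 1)) (ψ z.1) z.2 (Z z.2))

theorem contMDiff_solitonFamily (h : IsFlowOf X ψ) (hg : IsAdapted 𝓕 g) :
    ContMDiff (𝓘(ℝ, ℝ).prod (𝓡 (n + 1)))
      ((𝓡 (n + 1)).prod 𝓘(ℝ, EuclideanSpace ℝ (Fin (n + 1)) →L[ℝ]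
        EuclideanSpace ℝ (Fin (n + 1)) →L[ℝ] ℝ)) ∞
      (fun q : ℝ × M => TotalSpace.mk'
        (E := fun p : M => TangentSpace (𝓡 (n + 1)) p →L[ℝ] TangentSpace (𝓡 (n + 1)) p →L[ℝ] ℝ)
        (EuclideanSpace ℝ (Fin (n + 1)) →L[ℝ] EuclideanSpace ℝ (Fin (n + 1)) →L[ℝ] ℝ)
        q.2 ((solitonFamily hg ε ψ q.1).inner q.2)) := fun z =>
  contMDiffAt_bilin_of_forall contMDiffAt_snd fun _ _ hY hZ =>
    h.contMDiffAt_solitonFamily_inner_apply hg z hY hZ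

/-- Writing ψ_s = ψ_{s−t} ∘ ψ_t moves the derivative to time 0 at the point ψ_t p, where it is a Lie
derivative and the soliton equation applies. -/
theorem hasDerivAt_solitonFamily [T2Space M] (h : IsFlowOf X ψ) (hX : FieldPreservesFN 𝓕 X)
    (hg : IsAdapted 𝓕 g) {nabla : Connection n M}
    (heq : ∀ Y Z : VectorField n M, SmoothField Y → SmoothField Z → ∀ p,
      hTensor f 𝓕 g nabla p (Y p) (Z p) =
        ε * truncated 𝓕 g p (Y p) (Z p) + lieDerivative X (truncated 𝓕 g) Y Z p)
    (t : ℝ) (p : M) (v w : TangentSpace (𝓡 (n + 1)) p) :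
    HasDerivAt (fun s => (solitonFamily hg ε ψ s).inner p v w)
      (Real.exp (ε * t) * hTensor f 𝓕 g nabla (ψ t p) (tangentEquiv (ψ t) p v)
        (tangentEquiv (ψ t) p w)) t := by
  -- The soliton equation is an identity for fields, so the transported vectors are extended to
  -- smooth fields.
  obtain ⟨Y, hY, hYp⟩ := exists_smoothField (ψ t p) (tangentEquiv (ψ t) p v)
  obtain ⟨Z, hZ, hZp⟩ := exists_smoothField (ψ t p) (tangentEquiv (ψ t) p w)
  have hF : HasDerivAt (fun s => pullback (ψ s) (truncated 𝓕 g) p v w)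
      (lieDerivative X (truncated 𝓕 g) Y Z (ψ t p)) t := by
    have h1 := hasDerivWithinAt_univ.1 <| h.isVariation.hasDerivWithinAt_truncated hg
      (fun s _ => (h.preservesFN hX hg s (ψ t p)).2) (hX.2.2 _) (hX.1.mDiffField _)
      (hY.mDiffField _) (hZ.mDiffField _)
    rw [← sub_self t] at h1
    refine (h1.comp_sub_const t t).congr_of_eventuallyEq (.of_forall fun s => ?_)
    rw [hYp, hZp]
    change truncated 𝓕 g (ψ s p) (h.deriv s p v) (h.deriv s p w) =
      truncated 𝓕 g (ψ (s - t) (ψ t p)) (h.deriv (s - t) (ψ t p) (h.deriv t p v))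
        (h.deriv (s - t) (ψ t p) (h.deriv t p w))
    obtain ⟨r, rfl⟩ : ∃ r, s = r + t := ⟨s - t, (sub_add_cancel s t).symm⟩
    rw [add_sub_cancel_right, h.add, h.deriv_add]
    rfl
  have hc : HasDerivAt (fun s => Real.exp (ε * s)) (Real.exp (ε * t) * ε) t := by
    simpa using ((hasDerivAt_id t).const_mul ε).exp
  have h2 := (hc.mul hF).add_const (g.inner p v (𝓕.normal p) * g.inner p w (𝓕.normal p))
  refine (h2.congr_of_eventuallyEq (.of_forall fun s =>
    h.solitonFamily_inner hX hg s p v w)).congr_deriv ?_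
  rw [← hYp, ← hZp, heq Y Z hY hZ, hYp, hZp, pullback, ← tangentEquiv_apply, ← tangentEquiv_apply]
  ring

/-- The time derivative e^{εt} ψ_t^*h(b) equals h(b_t) by homogeneity under the leafwise scaling and
naturality under ψ_t. -/
theorem isEGF_solitonFamily [T2Space M] (h : IsFlowOf X ψ) (hX : FieldPreservesFN 𝓕 X)
    (hg : IsAdapted 𝓕 g) (heq : SolitonEquation f 𝓕 g X ε) :
    IsEGF f 𝓕 univ (solitonFamily hg ε ψ) where
  adapted t _ := h.isAdapted_solitonFamily hX hg t
  smooth := (h.contMDiff_solitonFamily hg).contMDiffOn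
  flow t _ := by
    obtain ⟨nabla, hLC, heq⟩ := heq
    have hc := Real.exp_pos (ε * t)
    refine ⟨pullbackConnection (ψ t) (rescaleConnection 𝓕 g nabla (Real.exp (ε * t))),
      (hLC.rescale hg hc).pullback (ψ t), fun p v w => ?_⟩
    rw [hasDerivWithinAt_univ, solitonFamily, hTensor_pullback f (h.preservesFN hX hg t),
      hTensor_rescale f hg hc]
    exact h.hasDerivAt_solitonFamily hX hg heq t p v w

end IsFlowOf

theorem IsEGSStructure.exists_isSelfSimilarWith [T2Space M] (h : IsEGSStructure f 𝓕 g X ε) :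
    ∃ (ψ : ℝ → Diffeo n M) (γ : ℝ → Metric n M), IsFlowOf X ψ ∧ γ 0 = g ∧
      IsSelfSimilarWith f 𝓕 univ γ (fun t => Real.exp (ε * t)) ψ := by
  obtain ⟨ψ, hψ⟩ := h.complete
  refine ⟨ψ, solitonFamily h.adapted ε ψ, hψ, hψ.solitonFamily_zero h.adapted, ?_⟩
  exact
    { isEGF := hψ.isEGF_solitonFamily h.preserves h.adapted h.equation
      scale_smooth := (Real.contDiff_exp.comp (contDiff_const.mul contDiff_id)).contDiffOn
      scale_pos := fun t _ => Real.exp_pos _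
      scale_zero := by rw [mul_zero, Real.exp_zero]
      smooth := hψ.smooth
      preserves := fun t _ => hψ.preservesFN h.preserves h.adapted t
      init := hψ.zero
      selfSimilar := fun t _ p v w => by
        rw [hψ.solitonFamily_zero h.adapted]
        exact hψ.truncated_solitonFamily h.preserves h.adapted t p v w }

end Existence

end EGF

end

theorem mainTheorem1 {n : ℕ} {M : Type*} [TopologicalSpace M] [T2Space M]
    [ChartedSpace (EuclideanSpace ℝ (Fin (n + 1))) M] [IsManifold (𝓡 (n + 1)) ∞ M]
    (𝓕 : EGF.OrientedFoliation n M)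
    (f : Fin n → (Fin n → ℝ) → ℝ) (hf : ∀ j, ContDiff ℝ 2 (f j)) :
    (∀ (J : Set ℝ) (g : ℝ → EGF.Metric n M), J.OrdConnected → J.Nontrivial → (0 : ℝ) ∈ J →
      EGF.IsSelfSimilarEGS f 𝓕 J g →
      ∃ (X : EGF.VectorField n M) (ε : ℝ),
        EGF.FieldPreservesFN 𝓕 X ∧ EGF.SolitonEquation f 𝓕 (g 0) X ε) ∧
    (∀ (g₀ : EGF.Metric n M) (X : EGF.VectorField n M) (ε : ℝ),
      EGF.IsEGSStructure f 𝓕 g₀ X ε →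
      ∃ (ψ : ℝ → EGF.Diffeo n M) (g : ℝ → EGF.Metric n M),
        EGF.IsFlowOf X ψ ∧ g 0 = g₀ ∧
        EGF.IsSelfSimilarWith f 𝓕 univ g (fun t => Real.exp (ε * t)) ψ) := by
  exact ⟨fun _ _ hJ hJ' h0 h => EGF.exists_solitonEquation hJ hJ' h0 h,
    fun _ _ _ h => h.exists_isSelfSimilarWith⟩
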